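/- The binary Hamming graph $H(m,2)$ has vertex set $\mathbb{F}_2^m$, two vertices being adjacent iff they differ in exactly one entry; $d$ is the Hamming distance. Two codes $C,C'\subseteq\mathbb{F}_2^m$ are equivalent if some automorphism of the graph $H(m,2)$ maps $C$ onto $C'$. The minimum distance $\delta$ of $C$ is the smallest distance between distinct codewords (in particular $|C|\ge 2$). For a nonempty code $C$ let $C_i$ be the set of vertices at distance $i$ from $C$, and let the covering radius $\rho$ be the largest $i$ with $C_i\neq\emptyset$. The code $C$ is completely regular if for all $i,k$ and all $\gamma\in C_i$ the number of codewords at distance $k$ from $\gamma$ depends only on $i$ and $k$. It is completely transitive if there is a subgroup $G\le\operatorname{Aut}(H(m,2))$ such that each of $C_0,\dots,C_\rho$ is a $G$-orbit. For a $12\times 12$ Hadamard matrix $H$ (entries $\pm1$, $HH^T=12I$), the code $C(H)\subseteq\mathbb{F}_2^{12}$ consists of the vectors obtained from the rows of $H$ and of $-H$ by replacing $1$ by $0$ and $-1$ by $1$. A Hadamard $12$ code is $C(H)$ for a normalised such $H$, that is, one whose first row and first column have all entries equal to $1$. A punctured Hadamard $12$ code is obtained from a Hadamard $12$ code by deleting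 the first entry of every codeword. Theorem. Let $C$ be a binary completely regular code of length $m$ with minimum distance $\delta$. (a) If $m=12$ and $\delta=6$, then $C$ is equivalent to every Hadamard $12$ code. (b) If $m=11$ and $\delta=5$, then $C$ is equivalent to every punctured Hadamard $12$ code. Moreover, the codes $C$ in (a) and (b) are completely transitive. -/

import Mathlib

/-- The vertices of the binary Hamming graph `H(m,2)`: the `m`-tuples over `𝔽₂`. -/
abbrev HammingVertex (m : ℕ) : Type := Fin m → ZMod 2

/-- A binary code of length `m`: a set of vertices of `H(m,2)` (automatically finite). -/
abbrev BinaryCode (m : ℕ) : Type := Finset (HammingVertex m)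

/-- The binary Hamming graph `H(m,2)`: two vertices are adjacent iff they differ in precisely
one entry. -/
def hammingGraph (m : ℕ) : SimpleGraph (HammingVertex m) where
  Adj α β := hammingDist α β = 1
  symm := ⟨fun α β h => by rw [hammingDist_comm]; exact h⟩
  loopless := ⟨fun α h => by simp at h⟩

/-- The automorphism group of `H(m,2)`. -/
abbrev HammingAut (m : ℕ) : Type := hammingGraph m ≃g hammingGraph m

/-- Two codes in `H(m,2)` are equivalent if some automorphism of `H(m,2)` maps one onto the
other. -/
def AreEquivalentCodes {m : ℕ} (C D : BinaryCode m) : Prop :=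
  ∃ x : HammingAut m, C.image (fun α => x α) = D

/-- `δ` is the minimum distance of `C`: the smallest distance between distinct codewords
(so `C` has at least two codewords). -/
def HasMinDistance {m : ℕ} (C : BinaryCode m) (δ : ℕ) : Prop :=
  IsLeast {d : ℕ | ∃ α ∈ C, ∃ β ∈ C, α ≠ β ∧ hammingDist α β = d} δ

/-- The distance of the vertex `γ` from a (nonempty) code `C`. -/
noncomputable def distToCode {m : ℕ} (C : BinaryCode m) (γ : HammingVertex m) : ℕ :=
  sInf {d : ℕ | ∃ β ∈ C, hammingDist γ β = d}

/-- The cell `C_i` of the distance partition of `C`: the vertices at distance `i` from `C`. -/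
def distCell {m : ℕ} (C : BinaryCode m) (i : ℕ) : Set (HammingVertex m) :=
  {γ | distToCode C γ = i}

/-- The covering radius of `C`: the maximum distance of a vertex from `C`. -/
noncomputable def coveringRadius {m : ℕ} (C : BinaryCode m) : ℕ :=
  Finset.univ.sup (distToCode C)

/-- `C` is completely regular: for `γ ∈ C_i`, the number of codewords at distance `k` from `γ`
depends only on `i` and `k`. -/
def IsCompletelyRegular {m : ℕ} (C : BinaryCode m) : Prop :=
  ∀ i k : ℕ, ∀ γ ∈ distCell C i, ∀ γ' ∈ distCell C i,
    (C.filter fun β => hammingDist γ β = k).card = (C.filter fun β => hammingDist γ' β = k).card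

/-- `C` is completely transitive: there is a subgroup `G` of the automorphism group of `H(m,2)`
such that each cell `C_0, …, C_ρ` of the distance partition is a `G`-orbit. -/
def IsCompletelyTransitive {m : ℕ} (C : BinaryCode m) : Prop :=
  ∃ G : Subgroup (HammingAut m), ∀ i ≤ coveringRadius C,
    ∃ γ : HammingVertex m, distCell C i = MulAction.orbit G γ

/-- The map `κ` from `±1`-vectors to binary vectors, sending `-1` to `1` and `1` to `0`. -/
def signToBinary {m : ℕ} (r : Fin m → ℤ) : HammingVertex m :=
  fun j => if r j = -1 then 1 else 0

/-- The Hadamard code `C(H)`: all `κ(r)`, where `r` is a row of `H` or of `-H`. -/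
def hadamardCode {m : ℕ} (H : Matrix (Fin m) (Fin m) ℤ) : BinaryCode m :=
  Finset.univ.image (fun i => signToBinary (H i)) ∪
    Finset.univ.image (fun i => signToBinary ((-H) i))

/-- `D` is a Hadamard 12 code: it is generated by a Hadamard matrix of order 12 that is
normalised, that is, whose first row and first column have all entries equal to `1`. -/
def IsHadamardTwelveCode (D : BinaryCode 12) : Prop :=
  ∃ H : Matrix (Fin 12) (Fin 12) ℤ,
    H.IsHadamard ∧ (∀ j, H 0 j = 1) ∧ (∀ i, H i 0 = 1) ∧ D = hadamardCode H

/-- The punctured code of `C` with respect to `p`: delete the entry `p` from each codeword. -/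
def puncturedCode {m : ℕ} (p : Fin (m + 1)) (C : BinaryCode (m + 1)) : BinaryCode m :=
  C.image (fun α j => α (p.succAbove j))

/-- `D` is a punctured Hadamard 12 code: it arises from a Hadamard 12 code by deleting the first
entry of each codeword. -/
def IsPuncturedHadamardTwelveCode (D : BinaryCode 11) : Prop :=
  ∃ E : BinaryCode 12, IsHadamardTwelveCode E ∧ D = puncturedCode 0 E

/-- A normalised Hadamard matrix of order 12, from the quadratic residues modulo 11. -/
def paleyTwelve : Matrix (Fin 12) (Fin 12) ℤ := fun i j =>
  if i = 0 ∨ j = 0 then 1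
  else if (j.val + 11 - i.val) % 11 ∈ [0, 1, 3, 4, 5, 9] then -1 else 1

set_option maxRecDepth 100000 in
/-- Hadamard 12 codes exist. -/
theorem isHadamardTwelveCode_paleyTwelve : IsHadamardTwelveCode (hadamardCode paleyTwelve) := by
  refine ⟨paleyTwelve, ⟨?_, ?_, ?_⟩, by decide, by decide, rfl⟩
  · intro i j
    rw [Unitary.mem_iff]
    unfold paleyTwelve
    split_ifs <;> decide
  · ext i j
    revert i j
    simp only [Matrix.mul_apply, Matrix.conjTranspose_apply, star_trivial, Matrix.smul_apply,
      Matrix.one_apply, Fintype.card_fin]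
    decide +kernel
  · ext i j
    revert i j
    simp only [Matrix.mul_apply, Matrix.conjTranspose_apply, star_trivial, Matrix.smul_apply,
      Matrix.one_apply, Fintype.card_fin]
    decide +kernel

/-! Translate a codeword to zero and replace vertices by supports. Twice 3 (in length 11, twice 2)
does not exceed the minimum distance, so all vertices of weight 3 (resp. 2) lie in one cell.
Regularity then turns the words of minimum weight into a 3-design with blocks of size 6 on 12 points
(resp. a 2-design with blocks of size 5 on 11 points). Small block intersections and counting fix
the parameters (`three_design_twelve`, `two_design_eleven`) and lead to a pair of antipodal
codewords. By regularity the code is closed under antipodes, so it has 24 words at distances 0, 6,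
12, or in length 11 becomes such a code under parity extension. Codes of Hadamard matrices are of
this kind too.

What remains is uniqueness of the resulting set family. A triple T lies on exactly two blocks, which
split the points into triples T, X, Y, Z. The members meeting T once behave like words of length
four, any two agreeing in one place. This allows a labelling of the points for which six prescribed
blocks occur, and these determine the family by a finite check (`card_standardHadamardFamily_le`).
The labelling may start from any ordered triple and any point of Z (`IsHadamardFamily.exists_perm`).
Coset leaders have weight at most 4, and those of weight 4 have exactly this shape, so any vertex
can be moved to a standard vertex while the code moves to a standard code (`HasStandardForm`).
Equivalence and complete transitivity both follow; for punctured codes the labelling fixes the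
deleted point. -/

/-! ### Counting in designs -/

open Finset in
-- Double count of the pairs (T, B) with T a `t`-subset of `B ∩ S`. For t = 1, 2, 3 it yields the
-- binomial moments of the intersection sizes.
theorem sum_choose_card_inter {α : Type*} [DecidableEq α] (𝓑 : Finset (Finset α)) (S : Finset α)
    (t l : ℕ) (h : ∀ T : Finset α, T ⊆ S → #T = t → #{B ∈ 𝓑 | T ⊆ B} = l) :
    ∑ B ∈ 𝓑, (#(B ∩ S)).choose t = (#S).choose t * l := by
  have key : ∀ B : Finset α, powersetCard t (B ∩ S) = {T ∈ powersetCard t S | T ⊆ B} := by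
    intro B
    ext T
    simp only [mem_powersetCard, mem_filter, subset_inter_iff]
    tauto
  simp_rw [← card_powersetCard, key, card_filter]
  rw [sum_comm]
  simp_rw [← card_filter]
  rw [sum_congr rfl (g := fun _ => l), sum_const, smul_eq_mul]
  intro T hT
  exact h T (mem_powersetCard.1 hT).1 (mem_powersetCard.1 hT).2

open Finset in
/-- Counting the blocks through a point set by extending the point set by one further point. -/
theorem card_blocks_mul_eq {α : Type*} [Fintype α] [DecidableEq α] (𝓑 : Finset (Finset α))
    (k l : ℕ) (hk : ∀ B ∈ 𝓑, #B = k) (T : Finset α)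
    (h : ∀ x ∉ T, #{B ∈ 𝓑 | insert x T ⊆ B} = l) :
    #{B ∈ 𝓑 | T ⊆ B} * (k - #T) = (Fintype.card α - #T) * l := by
  -- Both sides count the pairs (x, B) with T ⊆ B and x ∈ B \ T.
  have h1 : ∑ B ∈ 𝓑 with T ⊆ B, #(B \ T) = #{B ∈ 𝓑 | T ⊆ B} * (k - #T) := by
    rw [sum_congr rfl (g := fun _ => k - #T), sum_const, smul_eq_mul]
    intro B hB
    rw [mem_filter] at hB
    rw [card_sdiff_of_subset hB.2, hk B hB.1]
  have h2 : ∑ B ∈ 𝓑 with T ⊆ B, #(B \ T) = ∑ x ∈ Tᶜ, #{B ∈ 𝓑 | insert x T ⊆ B} := by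
    have key : ∀ B : Finset α, B \ T = {x ∈ Tᶜ | x ∈ B} := by
      intro B
      ext x
      simp [and_comm]
    simp_rw [key, card_filter _ Tᶜ]
    rw [sum_comm]
    simp_rw [← card_filter, filter_filter, insert_subset_iff, and_comm]
  rw [← h1, h2, sum_congr rfl (g := fun _ => l), sum_const, smul_eq_mul, card_compl]
  intro x hx
  exact h x (mem_compl.1 hx)

open Finset in
/-- Blocks of size `k` through `T` that pairwise meet in at most `#T` points are disjoint
outside `T`. -/
theorem card_blocks_mul_le {α : Type*} [Fintype α] [DecidableEq α] (𝓑 : Finset (Finset α))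
    (k : ℕ) (hk : ∀ B ∈ 𝓑, #B = k) (T : Finset α)
    (h : ∀ B ∈ 𝓑, ∀ B' ∈ 𝓑, B ≠ B' → #(B ∩ B') ≤ #T) :
    #{B ∈ 𝓑 | T ⊆ B} * (k - #T) ≤ Fintype.card α - #T := by
  have hd : ((({B ∈ 𝓑 | T ⊆ B} : Finset (Finset α)) : Set (Finset α))).PairwiseDisjoint
      (fun B => B \ T) := by
    intro B hB B' hB' hne
    simp only [coe_filter, Set.mem_ofPred_eq] at hB hB'
    have hT : T = B ∩ B' :=
      eq_of_subset_of_card_le (subset_inter hB.2 hB'.2) (h B hB.1 B' hB'.1 hne)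
    simp only [Function.onFun]
    rw [disjoint_left]
    intro x hx hx'
    rw [mem_sdiff] at hx hx'
    exact hx.2 (hT ▸ mem_inter.2 ⟨hx.1, hx'.1⟩)
  have h1 := card_biUnion (fun B hB B' hB' hne => hd hB hB' hne)
  rw [sum_congr rfl (g := fun _ => k - #T), sum_const, smul_eq_mul] at h1
  · rw [← h1, ← card_compl]
    refine card_le_card fun x hx => ?_
    simp only [mem_biUnion, mem_sdiff, mem_filter] at hx
    obtain ⟨B, -, -, hx⟩ := hx
    exact mem_compl.2 hx
  · intro B hB
    rw [mem_filter] at hB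
    rw [card_sdiff_of_subset hB.2, hk B hB.1]

open Finset symmDiff in
theorem card_symmDiff_add_two_mul_card_inter {α : Type*} [DecidableEq α] (A B : Finset α) :
    #(A ∆ B) + 2 * #(A ∩ B) = #A + #B := by
  have h1 := card_sdiff_add_card_inter A B
  have h2 := card_sdiff_add_card_inter B A
  have h3 : #(A ∆ B) = #(A \ B) + #(B \ A) := by
    rw [symmDiff_def, sup_eq_union, card_union_of_disjoint]
    exact disjoint_sdiff_sdiff
  rw [inter_comm B A] at h2
  omega

open Finset in
theorem eq_compl_of_card_inter_eq_zero {α : Type*} [Fintype α] [DecidableEq α] {A B : Finset α}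
    (h : #(A ∩ B) = 0) (hc : #A + #B = Fintype.card α) : A = Bᶜ := by
  apply eq_of_subset_of_card_le
  · rw [card_eq_zero] at h
    exact subset_compl_iff_disjoint_right.2 (disjoint_iff_inter_eq_empty.2 h)
  · rw [card_compl]
    omega

open Finset in
/-- The quasi-symmetric `3`-designs on twelve points with block size six. -/
theorem three_design_twelve (𝓑 : Finset (Finset (Fin 12))) (hk : ∀ B ∈ 𝓑, #B = 6)
    (hne : 𝓑.Nonempty) (hI : ∀ B ∈ 𝓑, ∀ B' ∈ 𝓑, B ≠ B' → #(B ∩ B') ≤ 3) (l : ℕ)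
    (hl : ∀ T : Finset (Fin 12), #T = 3 → #{B ∈ 𝓑 | T ⊆ B} = l) :
    #𝓑 = 22 ∧ ∀ B ∈ 𝓑, Bᶜ ∈ 𝓑 := by
  have hpos : 1 ≤ l := by
    obtain ⟨B, hB⟩ := hne
    obtain ⟨T, hTB, hT⟩ := exists_subset_card_eq (s := B) (n := 3) (by rw [hk B hB]; norm_num)
    rw [← hl T hT, Nat.one_le_iff_ne_zero, card_ne_zero]
    exact ⟨B, mem_filter.2 ⟨hB, hTB⟩⟩
  -- Blocks through a triple use disjoint sets of three among the nine other points.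
  have hle : l ≤ 3 := by
    obtain ⟨T, -, hT⟩ := exists_subset_card_eq (s := (univ : Finset (Fin 12))) (n := 3) (by simp)
    have := card_blocks_mul_le 𝓑 6 hk T (by rwa [hT])
    rw [hl T hT, hT] at this
    simp at this
    omega
  have h2 : ∀ T : Finset (Fin 12), #T = 2 → #{B ∈ 𝓑 | T ⊆ B} * 4 = 10 * l := by
    intro T hT
    have := card_blocks_mul_eq 𝓑 6 l hk T
      (fun x hx => hl _ (by rw [card_insert_of_notMem hx, hT]))
    rw [hT] at this
    simpa using this
  -- Divisibility of 10 * l by 4 makes l even.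
  have hl2 : l = 2 := by
    obtain ⟨T, -, hT⟩ := exists_subset_card_eq (s := (univ : Finset (Fin 12))) (n := 2) (by simp)
    have := h2 T hT
    omega
  subst hl2
  have h2' : ∀ T : Finset (Fin 12), #T = 2 → #{B ∈ 𝓑 | T ⊆ B} = 5 := by
    intro T hT
    have := h2 T hT
    omega
  have h1 : ∀ T : Finset (Fin 12), #T = 1 → #{B ∈ 𝓑 | T ⊆ B} = 11 := by
    intro T hT
    have := card_blocks_mul_eq 𝓑 6 5 hk T
      (fun x hx => h2' _ (by rw [card_insert_of_notMem hx, hT]))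
    rw [hT] at this
    simp at this
    omega
  have h0 : #𝓑 = 22 := by
    have := card_blocks_mul_eq 𝓑 6 11 hk ∅
      (fun x hx => h1 _ (by rw [card_insert_of_notMem hx]; simp))
    simp at this
    omega
  refine ⟨h0, fun B hB => ?_⟩
  by_contra hcon
  have s1 := sum_choose_card_inter 𝓑 B 1 11 (fun T _ hT => h1 T hT)
  have s2 := sum_choose_card_inter 𝓑 B 2 5 (fun T _ hT => h2' T hT)
  have s3 := sum_choose_card_inter 𝓑 B 3 2 (fun T _ hT => hl T hT)
  have s0 : ∑ _B' ∈ 𝓑, 1 = 22 := by simp [h0]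
  rw [hk B hB] at s1 s2 s3
  rw [← add_sum_erase _ _ hB] at s0 s1 s2 s3
  rw [inter_self, hk B hB] at s1 s2 s3
  -- The polynomial C(i,3) - C(i,2) + i - 1 = (i-1)(i-2)(i-3)/6 vanishes at 1, 2, 3. If no block
  -- were disjoint from B its sum over the other blocks would be 0, but the moments give -1.
  have key : ∑ B' ∈ 𝓑.erase B, ((#(B' ∩ B)).choose 3 + (#(B' ∩ B)).choose 1) =
      ∑ B' ∈ 𝓑.erase B, ((#(B' ∩ B)).choose 2 + 1) := by
    refine sum_congr rfl fun B' hB' => ?_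
    obtain ⟨hne', hB'⟩ := mem_erase.1 hB'
    have hi := hI B' hB' B hB hne'
    have hi0 : #(B' ∩ B) ≠ 0 := by
      intro h
      have := eq_compl_of_card_inter_eq_zero h (by rw [hk B hB, hk B' hB']; simp)
      exact hcon (this ▸ hB')
    generalize #(B' ∩ B) = i at hi hi0
    interval_cases i <;> first | rfl | omega
  rw [sum_add_distrib, sum_add_distrib] at key
  norm_num [Nat.choose] at s0 s1 s2 s3 key
  omega

open Finset in
/-- The quasi-symmetric `2`-designs on eleven points with block size five are biplanes. -/
theorem two_design_eleven (𝓑 : Finset (Finset (Fin 11))) (hk : ∀ B ∈ 𝓑, #B = 5)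
    (hne : 𝓑.Nonempty) (hI : ∀ B ∈ 𝓑, ∀ B' ∈ 𝓑, B ≠ B' → #(B ∩ B') ≤ 2) (l : ℕ)
    (hl : ∀ T : Finset (Fin 11), #T = 2 → #{B ∈ 𝓑 | T ⊆ B} = l) :
    #𝓑 = 11 ∧ (∀ T : Finset (Fin 11), #T = 1 → #{B ∈ 𝓑 | T ⊆ B} = 5) ∧
      ∀ T : Finset (Fin 11), #T = 2 → #{B ∈ 𝓑 | T ⊆ B} = 2 := by
  have hpos : 1 ≤ l := by
    obtain ⟨B, hB⟩ := hne
    obtain ⟨T, hTB, hT⟩ := exists_subset_card_eq (s := B) (n := 2) (by rw [hk B hB]; norm_num)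
    rw [← hl T hT, Nat.one_le_iff_ne_zero, card_ne_zero]
    exact ⟨B, mem_filter.2 ⟨hB, hTB⟩⟩
  have hle : l ≤ 3 := by
    obtain ⟨T, -, hT⟩ := exists_subset_card_eq (s := (univ : Finset (Fin 11))) (n := 2) (by simp)
    have := card_blocks_mul_le 𝓑 5 hk T (by rwa [hT])
    rw [hl T hT, hT] at this
    simp at this
    omega
  have h1 : ∀ T : Finset (Fin 11), #T = 1 → #{B ∈ 𝓑 | T ⊆ B} * 4 = 10 * l := by
    intro T hT
    have := card_blocks_mul_eq 𝓑 5 l hk T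
      (fun x hx => hl _ (by rw [card_insert_of_notMem hx, hT]))
    rw [hT] at this
    simpa using this
  have hl2 : l = 2 := by
    have := h1 {0} (by simp)
    omega
  subst hl2
  have h1' : ∀ T : Finset (Fin 11), #T = 1 → #{B ∈ 𝓑 | T ⊆ B} = 5 := by
    intro T hT
    have := h1 T hT
    omega
  refine ⟨?_, h1', hl⟩
  have := card_blocks_mul_eq 𝓑 5 5 hk ∅
    (fun x hx => h1' _ (by rw [card_insert_of_notMem hx]; simp))
  simp at this
  omega

open Finset in
/-- A six-subset meeting every block of the biplane on eleven points in at most three points is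
the complement of a block. -/
theorem compl_mem_biplane_of_card_inter_le (𝓑 : Finset (Finset (Fin 11)))
    (hk : ∀ B ∈ 𝓑, #B = 5) (h0 : #𝓑 = 11)
    (h1 : ∀ T : Finset (Fin 11), #T = 1 → #{B ∈ 𝓑 | T ⊆ B} = 5)
    (h2 : ∀ T : Finset (Fin 11), #T = 2 → #{B ∈ 𝓑 | T ⊆ B} = 2)
    (W : Finset (Fin 11)) (hW : #W = 6) (hI : ∀ B ∈ 𝓑, #(B ∩ W) ≤ 3) : Wᶜ ∈ 𝓑 := by
  by_contra hcon
  have s1 := sum_choose_card_inter 𝓑 W 1 5 (fun T _ hT => h1 T hT)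
  have s2 := sum_choose_card_inter 𝓑 W 2 2 (fun T _ hT => h2 T hT)
  have s0 : ∑ _B ∈ 𝓑, 1 = 11 := by simp [h0]
  -- This is (i-1)(i-3) ≤ 0 for 1 ≤ i ≤ 3; summed over the blocks it would read 93 ≤ 90.
  have key : ∑ B ∈ 𝓑, (2 * (#(B ∩ W)).choose 2 + 3 * 1) ≤ ∑ B ∈ 𝓑, 3 * (#(B ∩ W)).choose 1 := by
    refine sum_le_sum fun B hB => ?_
    have hi := hI B hB
    have hi0 : #(B ∩ W) ≠ 0 := by
      intro h
      have := eq_compl_of_card_inter_eq_zero h (by rw [hk B hB, hW]; simp)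
      exact hcon (this ▸ hB)
    generalize #(B ∩ W) = i at hi hi0
    interval_cases i <;> simp [Nat.choose] at hi0 ⊢
  rw [sum_add_distrib, ← mul_sum, ← mul_sum, ← mul_sum, s0, s1, s2, hW] at key
  norm_num [Nat.choose] at key

/-! ### Hadamard families: two blocks through every triple -/

open Finset symmDiff in
/-- The supports of the codewords of a binary Hadamard code of length twelve containing zero. -/
structure IsHadamardFamily (F : Finset (Finset (Fin 12))) : Prop where
  empty_mem : ∅ ∈ F
  compl_mem : ∀ A ∈ F, Aᶜ ∈ F
  card_symmDiff : ∀ A ∈ F, ∀ B ∈ F, #(A ∆ B) = 0 ∨ #(A ∆ B) = 6 ∨ #(A ∆ B) = 12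
  card_eq : #F = 24

open Finset in
theorem card_union_add_of_inter_eq {α : Type*} [DecidableEq α] {P Q R U : Finset α}
    (h1 : P ∩ Q = U) (h2 : P ∩ R = U) (h3 : Q ∩ R = U) :
    #(P ∪ Q ∪ R) + 2 * #U = #P + #Q + #R := by
  have e1 := card_union_add_card_inter P Q
  have e2 := card_union_add_card_inter (P ∪ Q) R
  rw [union_inter_distrib_right, h2, h3, union_self] at e2
  rw [h1] at e1
  omega

namespace IsHadamardFamily

open Finset symmDiff

variable {F : Finset (Finset (Fin 12))}

theorem eq_empty_or_univ_or_card (hF : IsHadamardFamily F) {A : Finset (Fin 12)} (hA : A ∈ F) :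
    A = ∅ ∨ A = univ ∨ #A = 6 := by
  have h := hF.card_symmDiff A hA ∅ hF.empty_mem
  rw [← bot_eq_empty, symmDiff_bot] at h
  rcases h with h | h | h
  · exact Or.inl (card_eq_zero.1 h)
  · exact Or.inr (Or.inr h)
  · exact Or.inr (Or.inl ((card_eq_iff_eq_univ _).1 (by simpa using h)))

theorem univ_mem (hF : IsHadamardFamily F) : univ ∈ F := by
  simpa using hF.compl_mem ∅ hF.empty_mem

theorem eq_or_eq_compl_or_card_inter (hF : IsHadamardFamily F) {A B : Finset (Fin 12)}
    (hA : A ∈ F) (hB : B ∈ F) (hA6 : #A = 6) (hB6 : #B = 6) :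
    A = B ∨ A = Bᶜ ∨ #(A ∩ B) = 3 := by
  have h1 := card_symmDiff_add_two_mul_card_inter A B
  rcases hF.card_symmDiff A hA B hB with h | h | h
  · exact Or.inl (symmDiff_eq_bot.1 (card_eq_zero.1 h))
  · exact Or.inr (Or.inr (by omega))
  · exact Or.inr (Or.inl (eq_compl_of_card_inter_eq_zero (by omega) (by simp [hA6, hB6])))

theorem card_blocks (hF : IsHadamardFamily F) : #{B ∈ F | #B = 6} = 22 := by
  have h : F = insert ∅ (insert univ {B ∈ F | #B = 6}) := by
    ext A
    simp only [mem_insert, mem_filter]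
    constructor
    · intro hA
      rcases hF.eq_empty_or_univ_or_card hA with h | h | h
      · exact Or.inl h
      · exact Or.inr (Or.inl h)
      · exact Or.inr (Or.inr ⟨hA, h⟩)
    · rintro (h | h | h)
      · exact h ▸ hF.empty_mem
      · exact h ▸ hF.univ_mem
      · exact h.1
  have h24 := hF.card_eq
  rw [h, card_insert_of_notMem, card_insert_of_notMem] at h24
  · omega
  · simp
  · simp only [mem_insert, mem_filter, card_empty]
    rintro (h | h)
    · simpa using congrArg card h
    · omega

theorem card_inter_eq_three (hF : IsHadamardFamily F) {A B T : Finset (Fin 12)}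
    (hA : A ∈ F) (hB : B ∈ F) (hA6 : #A = 6) (hB6 : #B = 6) (hne : A ≠ B)
    (hT : T.Nonempty) (hTA : T ⊆ A) (hTB : T ⊆ B) : #(A ∩ B) = 3 := by
  rcases hF.eq_or_eq_compl_or_card_inter hA hB hA6 hB6 with h | h | h
  · exact absurd h hne
  · obtain ⟨x, hx⟩ := hT
    have := hTA hx
    rw [h, mem_compl] at this
    exact absurd (hTB hx) this
  · exact h

theorem inter_eq_of_card (hF : IsHadamardFamily F) {A B T : Finset (Fin 12)}
    (hA : A ∈ F) (hB : B ∈ F) (hA6 : #A = 6) (hB6 : #B = 6) (hne : A ≠ B)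
    (hT : #T = 3) (hTA : T ⊆ A) (hTB : T ⊆ B) : A ∩ B = T :=
  (eq_of_subset_of_card_le (subset_inter hTA hTB) (by
    rw [hF.card_inter_eq_three hA hB hA6 hB6 hne (card_pos.1 (by omega)) hTA hTB, hT])).symm

/-- Three blocks through T pairwise meet only in T, so they cover all 3 + 3 · 3 points. A further
block V, neither one of them nor a complement, meets each in three points, whence 6 + 2 · #(V ∩ T) =
9, which parity excludes. -/
theorem card_blocks_through_le (hF : IsHadamardFamily F) {T : Finset (Fin 12)} (hT : #T = 3) :
    #{B ∈ {B ∈ F | #B = 6} | T ⊆ B} ≤ 2 := by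
  by_contra! hcon
  obtain ⟨A, hA, B, hB, D, hD, hAB, hAD, hBD⟩ := two_lt_card.1 hcon
  simp only [mem_filter] at hA hB hD
  have i1 := hF.inter_eq_of_card hA.1.1 hB.1.1 hA.1.2 hB.1.2 hAB hT hA.2 hB.2
  have i2 := hF.inter_eq_of_card hA.1.1 hD.1.1 hA.1.2 hD.1.2 hAD hT hA.2 hD.2
  have i3 := hF.inter_eq_of_card hB.1.1 hD.1.1 hB.1.2 hD.1.2 hBD hT hB.2 hD.2
  obtain ⟨V, hV, hV'⟩ := exists_mem_notMem_of_card_lt_card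
    (s := ({A, B, D, Aᶜ, Bᶜ, Dᶜ} : Finset (Finset (Fin 12)))) (t := {B ∈ F | #B = 6})
    (lt_of_le_of_lt card_le_six (by rw [hF.card_blocks]; norm_num))
  simp only [mem_insert, mem_singleton, not_or] at hV'
  rw [mem_filter] at hV
  have v1 := (hF.eq_or_eq_compl_or_card_inter hV.1 hA.1.1 hV.2 hA.1.2).resolve_left hV'.1
    |>.resolve_left hV'.2.2.2.1
  have v2 := (hF.eq_or_eq_compl_or_card_inter hV.1 hB.1.1 hV.2 hB.1.2).resolve_left hV'.2.1
    |>.resolve_left hV'.2.2.2.2.1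
  have v3 := (hF.eq_or_eq_compl_or_card_inter hV.1 hD.1.1 hV.2 hD.1.2).resolve_left hV'.2.2.1
    |>.resolve_left hV'.2.2.2.2.2
  have hu : A ∪ B ∪ D = univ := by
    have := card_union_add_of_inter_eq i1 i2 i3
    exact (card_eq_iff_eq_univ _).1 (by rw [Fintype.card_fin]; omega)
  have := card_union_add_of_inter_eq (P := V ∩ A) (Q := V ∩ B) (R := V ∩ D) (U := V ∩ T)
    (by rw [← inter_inter_distrib_left, i1]) (by rw [← inter_inter_distrib_left, i2])
    (by rw [← inter_inter_distrib_left, i3])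
  rw [← inter_union_distrib_left, ← inter_union_distrib_left, hu, inter_univ] at this
  omega

/-- The upper bound 2 is also the average: 22 blocks contain 22 · 20 = 440 triples, twice the number
220 of all triples. -/
theorem card_blocks_through (hF : IsHadamardFamily F) {T : Finset (Fin 12)} (hT : #T = 3) :
    #{B ∈ {B ∈ F | #B = 6} | T ⊆ B} = 2 := by
  have h1 : ∑ T ∈ powersetCard 3 (univ : Finset (Fin 12)), #{B ∈ {B ∈ F | #B = 6} | T ⊆ B} =
      ∑ _T ∈ powersetCard 3 (univ : Finset (Fin 12)), 2 := by
    have key : ∀ B : Finset (Fin 12),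
        {T ∈ powersetCard 3 (univ : Finset (Fin 12)) | T ⊆ B} = powersetCard 3 B := by
      intro B
      ext T
      simp only [mem_powersetCard, mem_filter, subset_univ, true_and]
      tauto
    simp_rw [card_filter (fun B => (_ : Finset (Fin 12)) ⊆ B) _]
    rw [sum_comm]
    simp_rw [← card_filter, key, card_powersetCard]
    rw [sum_congr rfl (g := fun _ => 20), sum_const, sum_const, hF.card_blocks]
    · simp [Nat.choose]
    · intro B hB
      rw [(mem_filter.1 hB).2]
      rfl
  have h2 := (sum_eq_sum_iff_of_le (fun T hT => hF.card_blocks_through_le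
    (mem_powersetCard.1 hT).2)).1 h1
  exact h2 T (mem_powersetCard.2 ⟨subset_univ _, hT⟩)

end IsHadamardFamily

/-! ### The four cells of a triple -/

open Finset in
/-- The partition of the twelve points induced by the two blocks `T ∪ X` and `T ∪ Y` through the
triple `T`. -/
structure IsTripleCells (F : Finset (Finset (Fin 12))) (T X Y Z : Finset (Fin 12)) : Prop where
  card_T : #T = 3
  card_X : #X = 3
  card_Y : #Y = 3
  card_Z : #Z = 3
  disj_TX : Disjoint T X
  disj_TY : Disjoint T Y
  disj_TZ : Disjoint T Z
  disj_XY : Disjoint X Y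
  disj_XZ : Disjoint X Z
  disj_YZ : Disjoint Y Z
  union_eq : T ∪ X ∪ Y ∪ Z = univ
  mem_TX : T ∪ X ∈ F
  mem_TY : T ∪ Y ∈ F
  eq_or_eq : ∀ A ∈ F, #A = 6 → T ⊆ A → A = T ∪ X ∨ A = T ∪ Y

open Finset in
theorem IsHadamardFamily.exists_isTripleCells {F : Finset (Finset (Fin 12))}
    (hF : IsHadamardFamily F) {T : Finset (Fin 12)} (hT : #T = 3) :
    ∃ X Y Z, IsTripleCells F T X Y Z := by
  obtain ⟨A, B, hAB, h⟩ := card_eq_two.1 (hF.card_blocks_through hT)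
  have hA : A ∈ ({A, B} : Finset (Finset (Fin 12))) := by simp
  have hB : B ∈ ({A, B} : Finset (Finset (Fin 12))) := by simp
  rw [← h] at hA hB
  simp only [mem_filter] at hA hB
  have hI := hF.inter_eq_of_card hA.1.1 hB.1.1 hA.1.2 hB.1.2 hAB hT hA.2 hB.2
  have hU := card_union_add_card_inter A B
  rw [hI, hT, hA.1.2, hB.1.2] at hU
  refine ⟨A \ T, B \ T, (A ∪ B)ᶜ, hT, ?_, ?_, ?_, disjoint_sdiff, disjoint_sdiff, ?_, ?_, ?_, ?_,
    ?_, ?_, ?_, ?_⟩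
  · rw [card_sdiff_of_subset hA.2]; omega
  · rw [card_sdiff_of_subset hB.2]; omega
  · rw [card_compl, Fintype.card_fin]; omega
  · rw [disjoint_left]
    intro x hx
    simp [hA.2 hx]
  · rw [disjoint_left]
    intro x hx hx'
    rw [mem_sdiff] at hx hx'
    exact hx.2 (hI ▸ mem_inter.2 ⟨hx.1, hx'.1⟩)
  · rw [disjoint_left]
    intro x hx
    simp [(mem_sdiff.1 hx).1]
  · rw [disjoint_left]
    intro x hx
    simp [(mem_sdiff.1 hx).1]
  · ext x
    simp only [mem_union, mem_sdiff, mem_compl, mem_univ, iff_true]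
    tauto
  · rw [union_sdiff_of_subset hA.2]; exact hA.1.1
  · rw [union_sdiff_of_subset hB.2]; exact hB.1.1
  · intro V hV hV6 hTV
    rw [union_sdiff_of_subset hA.2, union_sdiff_of_subset hB.2]
    have : V ∈ ({A, B} : Finset (Finset (Fin 12))) := by
      rw [← h]
      simp only [mem_filter]
      exact ⟨⟨hV, hV6⟩, hTV⟩
    simpa using this

open Finset in
theorem card_add_card_le_card_inter_add {α : Type*} [DecidableEq α] (A B S : Finset α) :
    #(A ∩ S) + #(B ∩ S) ≤ #(A ∩ B ∩ S) + #S := by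
  have h1 := card_union_add_card_inter (A ∩ S) (B ∩ S)
  rw [← inter_inter_distrib_right, ← union_inter_distrib_right] at h1
  have := card_le_card (inter_subset_right : (A ∪ B) ∩ S ⊆ S)
  omega

namespace IsTripleCells

open Finset

variable {F : Finset (Finset (Fin 12))} {T X Y Z : Finset (Fin 12)}

theorem card_eq_sum (h : IsTripleCells F T X Y Z) (S : Finset (Fin 12)) :
    #S = #(S ∩ T) + #(S ∩ X) + #(S ∩ Y) + #(S ∩ Z) := by
  have e : S = (S ∩ T) ∪ (S ∩ X) ∪ (S ∩ Y) ∪ (S ∩ Z) := by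
    rw [← inter_union_distrib_left, ← inter_union_distrib_left, ← inter_union_distrib_left,
      h.union_eq, inter_univ]
  conv_lhs => rw [e]
  have d : ∀ {P Q : Finset (Fin 12)}, Disjoint P Q → Disjoint (S ∩ P) (S ∩ Q) := fun hd =>
    hd.mono inter_subset_right inter_subset_right
  rw [card_union_of_disjoint, card_union_of_disjoint, card_union_of_disjoint]
  · exact d h.disj_TX
  · exact disjoint_union_left.2 ⟨d h.disj_TY, d h.disj_XY⟩
  · exact disjoint_union_left.2 ⟨disjoint_union_left.2 ⟨d h.disj_TZ, d h.disj_XZ⟩, d h.disj_YZ⟩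

/-- The members of the family that meet `T` in a single point. -/
theorem card_inter_cells (h : IsTripleCells F T X Y Z) (hF : IsHadamardFamily F)
    {A : Finset (Fin 12)} (hA : A ∈ F) (hAT : #(A ∩ T) = 1) :
    #A = 6 ∧ #(A ∩ X) = 2 ∧ #(A ∩ Y) = 2 ∧ #(A ∩ Z) = 1 := by
  have hA6 : #A = 6 := by
    rcases hF.eq_empty_or_univ_or_card hA with rfl | rfl | h6
    · simp at hAT
    · rw [univ_inter, h.card_T] at hAT
      omega
    · exact h6
  have key : ∀ W, #W = 3 → Disjoint T W → T ∪ W ∈ F → #(A ∩ W) = 2 := by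
    intro W hW hd hm
    have hc : #(T ∪ W) = 6 := by rw [card_union_of_disjoint hd, h.card_T, hW]
    have h3 : #(A ∩ (T ∪ W)) = #(A ∩ T) + #(A ∩ W) := by
      rw [inter_union_distrib_left, card_union_of_disjoint]
      exact hd.mono inter_subset_right inter_subset_right
    rcases hF.eq_or_eq_compl_or_card_inter hA hm hA6 hc with e | e | e
    · rw [e, union_inter_cancel_left, h.card_T] at hAT
      omega
    · have : A ∩ T = ∅ := by
        rw [e]
        ext x
        simp only [mem_inter, mem_compl, mem_union, notMem_empty]
        tauto
      rw [this] at hAT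
      simp at hAT
    · omega
  have hX := key X h.card_X h.disj_TX h.mem_TX
  have hY := key Y h.card_Y h.disj_TY h.mem_TY
  have := h.card_eq_sum A
  omega

/-- The complement of a set meeting T once meets it twice, so complementary pairs are excluded and
the two blocks share three points. -/
theorem card_inter_of_ne (h : IsTripleCells F T X Y Z) (hF : IsHadamardFamily F)
    {A B : Finset (Fin 12)} (hA : A ∈ F) (hAT : #(A ∩ T) = 1) (hB : B ∈ F) (hBT : #(B ∩ T) = 1)
    (hne : A ≠ B) :
    #(A ∩ B ∩ T) + #(A ∩ B ∩ X) + #(A ∩ B ∩ Y) + #(A ∩ B ∩ Z) = 3 := by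
  rw [← h.card_eq_sum]
  rcases hF.eq_or_eq_compl_or_card_inter hA hB (h.card_inter_cells hF hA hAT).1
    (h.card_inter_cells hF hB hBT).1 with e | e | e
  · exact absurd e hne
  · have e' : A ∩ T = T \ B := by
      rw [e]
      ext x
      simp [and_comm]
    have := card_sdiff_add_card_inter T B
    rw [← e', hAT, inter_comm, hBT, h.card_T] at this
    omega
  · exact e

/-- Complementation exchanges traces of sizes a and 3 - a on T. Only `univ` and the two blocks
through T contain T, so half of the 24 members, less at most three, meet T once. -/
theorem nine_le_card (h : IsTripleCells F T X Y Z) (hF : IsHadamardFamily F) :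
    9 ≤ #{A ∈ F | #(A ∩ T) = 1} := by
  have hc : ∀ A : Finset (Fin 12), #(Aᶜ ∩ T) + #(A ∩ T) = 3 := by
    intro A
    rw [← h.card_T, ← card_sdiff_add_card_inter T A, inter_comm A T]
    congr 2
    ext x
    simp [and_comm]
  have h24 : #F = ∑ a ∈ range 4, #{A ∈ F | #(A ∩ T) = a} := by
    apply card_eq_sum_card_fiberwise
    intro A _
    have := hc A
    simp only [coe_range, Set.mem_Iio]
    omega
  have hbij : ∀ a b, a + b = 3 → #{A ∈ F | #(A ∩ T) = a} = #{A ∈ F | #(A ∩ T) = b} := by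
    intro a b hab
    apply card_nbij' (fun A => Aᶜ) (fun A => Aᶜ)
    · intro A hA
      simp only [coe_filter, Set.mem_ofPred_eq] at hA ⊢
      have := hc A
      exact ⟨hF.compl_mem A hA.1, by omega⟩
    · intro A hA
      simp only [coe_filter, Set.mem_ofPred_eq] at hA ⊢
      have := hc A
      exact ⟨hF.compl_mem A hA.1, by omega⟩
    · intro A _
      simp
    · intro A _
      simp
  have h3 : #{A ∈ F | #(A ∩ T) = 3} ≤ 3 := by
    refine (card_le_card (t := {univ, T ∪ X, T ∪ Y}) fun A hA => ?_).trans card_le_three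
    rw [mem_filter] at hA
    have hTA : T ⊆ A := by
      have := eq_of_subset_of_card_le (inter_subset_right : A ∩ T ⊆ T) (by rw [hA.2, h.card_T])
      exact inter_eq_right.1 this
    simp only [mem_insert, mem_singleton]
    rcases hF.eq_empty_or_univ_or_card hA.1 with e | e | e
    · rw [e] at hA
      simp at hA
    · exact Or.inl e
    · exact Or.inr (h.eq_or_eq A hA.1 e hTA)
  rw [hF.card_eq] at h24
  simp only [sum_range_succ, sum_range_zero] at h24
  have := hbij 0 3 rfl
  have := hbij 1 2 rfl
  omega

/-- The members of the family meeting `T` in one point are determined by their traces on `T` and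
one further cell, and all conceivable traces occur. -/
theorem exists_mem_of_traces (h : IsTripleCells F T X Y Z) (hF : IsHadamardFamily F)
    {W : Finset (Fin 12)} {d : ℕ} (hW : #W = 3) (hd : (3 : ℕ).choose d = 3)
    (hWd : ∀ A ∈ F, #(A ∩ T) = 1 → #(A ∩ W) = d)
    (hinj : ∀ A ∈ F, #(A ∩ T) = 1 → ∀ B ∈ F, #(B ∩ T) = 1 →
      A ∩ T = B ∩ T → A ∩ W = B ∩ W → A = B)
    {P Q : Finset (Fin 12)} (hP : P ⊆ T) (hP1 : #P = 1) (hQ : Q ⊆ W) (hQd : #Q = d) :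
    ∃ A ∈ F, #(A ∩ T) = 1 ∧ A ∩ T = P ∧ A ∩ W = Q := by
  -- At least nine members are mapped injectively into 3 · 3 possible pairs of traces.
  have himg : image (fun A => (A ∩ T, A ∩ W)) {A ∈ F | #(A ∩ T) = 1} =
      powersetCard 1 T ×ˢ powersetCard d W := by
    apply eq_of_subset_of_card_le
    · intro x hx
      simp only [mem_image, mem_filter] at hx
      obtain ⟨A, hA, rfl⟩ := hx
      exact mem_product.2 ⟨mem_powersetCard.2 ⟨inter_subset_right, hA.2⟩,
        mem_powersetCard.2 ⟨inter_subset_right, hWd A hA.1 hA.2⟩⟩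
    · rw [card_product, card_powersetCard, card_powersetCard, hW, h.card_T, hd,
        card_image_of_injOn]
      · exact h.nine_le_card hF
      · intro A hA B hB hAB
        simp only [coe_filter, Set.mem_ofPred_eq] at hA hB
        simp only [Prod.mk.injEq] at hAB
        exact hinj A hA.1 hA.2 B hB.1 hB.2 hAB.1 hAB.2
  have hm : (P, Q) ∈ powersetCard 1 T ×ˢ powersetCard d W :=
    mem_product.2 ⟨mem_powersetCard.2 ⟨hP, hP1⟩, mem_powersetCard.2 ⟨hQ, hQd⟩⟩
  rw [← himg] at hm
  simp only [mem_image, mem_filter, Prod.mk.injEq] at hm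
  obtain ⟨A, hA, e1, e2⟩ := hm
  exact ⟨A, hA.1, hA.2, e1, e2⟩

/-- Members agreeing on T and Z share a point in each, and pairs inside the triples X and Y share at
least one more point each. That makes four common points, one too many for distinct members. -/
theorem exists_mem_of_traces_Z (h : IsTripleCells F T X Y Z) (hF : IsHadamardFamily F)
    {i l : Fin 12} (hi : i ∈ T) (hl : l ∈ Z) :
    ∃ A ∈ F, A ∩ T = {i} ∧ A ∩ Z = {l} := by
  have hinj : ∀ A ∈ F, #(A ∩ T) = 1 → ∀ B ∈ F, #(B ∩ T) = 1 →
      A ∩ T = B ∩ T → A ∩ Z = B ∩ Z → A = B := by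
    intro A hA hAT B hB hBT eT eZ
    by_contra hne
    have h3 := h.card_inter_of_ne hF hA hAT hB hBT hne
    have hT : #(A ∩ B ∩ T) = 1 := by rw [inter_inter_distrib_right, ← eT, inter_self, hAT]
    have hA' := h.card_inter_cells hF hA hAT
    have hB' := h.card_inter_cells hF hB hBT
    have hZ : #(A ∩ B ∩ Z) = 1 := by rw [inter_inter_distrib_right, ← eZ, inter_self, hA'.2.2.2]
    have hX := card_add_card_le_card_inter_add A B X
    have hY := card_add_card_le_card_inter_add A B Y
    rw [h.card_X] at hX
    rw [h.card_Y] at hY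
    omega
  obtain ⟨A, hA, -, e1, e2⟩ := h.exists_mem_of_traces hF (d := 1) h.card_Z rfl
    (fun A hA hAT => (h.card_inter_cells hF hA hAT).2.2.2) hinj
    (singleton_subset_iff.2 hi) (card_singleton i) (singleton_subset_iff.2 hl) (card_singleton l)
  exact ⟨A, hA, e1, e2⟩

/-- Agreement on T and X gives 1 + 2 common points, and Y adds at least one, again exceeding three.
-/
theorem exists_mem_of_traces_X (h : IsTripleCells F T X Y Z) (hF : IsHadamardFamily F)
    {i j : Fin 12} (hi : i ∈ T) (hj : j ∈ X) :
    ∃ A ∈ F, A ∩ T = {i} ∧ X \ A = {j} := by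
  have hinj : ∀ A ∈ F, #(A ∩ T) = 1 → ∀ B ∈ F, #(B ∩ T) = 1 →
      A ∩ T = B ∩ T → A ∩ X = B ∩ X → A = B := by
    intro A hA hAT B hB hBT eT eX
    by_contra hne
    have h3 := h.card_inter_of_ne hF hA hAT hB hBT hne
    have hT : #(A ∩ B ∩ T) = 1 := by rw [inter_inter_distrib_right, ← eT, inter_self, hAT]
    have hA' := h.card_inter_cells hF hA hAT
    have hB' := h.card_inter_cells hF hB hBT
    have hX : #(A ∩ B ∩ X) = 2 := by rw [inter_inter_distrib_right, ← eX, inter_self, hA'.2.1]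
    have hY := card_add_card_le_card_inter_add A B Y
    rw [h.card_Y] at hY
    omega
  obtain ⟨A, hA, -, e1, e2⟩ := h.exists_mem_of_traces hF (d := 2) h.card_X rfl
    (fun A hA hAT => (h.card_inter_cells hF hA hAT).2.1) hinj
    (singleton_subset_iff.2 hi) (card_singleton i) (sdiff_subset : X \ {j} ⊆ X)
    (by rw [card_sdiff_of_subset (singleton_subset_iff.2 hj), h.card_X, card_singleton])
  refine ⟨A, hA, e1, ?_⟩
  rw [← sdiff_inter_self_right, inter_comm, ← inter_comm A X, e2]
  simpa using hj

end IsTripleCells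

/-! ### The standard family and its determination by generators -/

section

open Finset symmDiff

/-- Five blocks and the empty set that determine a Hadamard family. -/
def hadamardFamilyGenerators : List (Finset (Fin 12)) :=
  [∅, {0, 1, 2, 3, 4, 5}, {0, 1, 2, 6, 7, 8}, {0, 4, 5, 7, 8, 9}, {0, 3, 5, 6, 8, 10},
    {0, 3, 4, 6, 7, 11}, {1, 4, 5, 6, 8, 11}]

/-- Only compatibility with the generators is required, so a Hadamard family containing them is
automatically a subfamily; the bound by 24 then turns inclusion into equality. -/
def standardHadamardFamily : Finset (Finset (Fin 12)) :=
  {A | ∀ S ∈ hadamardFamilyGenerators, #(A ∆ S) = 0 ∨ #(A ∆ S) = 6 ∨ #(A ∆ S) = 12}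

/-- The members of the standard Hadamard family as binary expansions. -/
def standardHadamardCodes : List ℕ :=
  [0, 63, 455, 746, 860, 945, 1268, 1385, 1434, 1619, 1677, 1830, 2265, 2418, 2476, 2661, 2710,
    2827, 3150, 3235, 3349, 3640, 4032, 4095]

/-- Each congruence stands directly after the last bit it involves, so that the exhaustive
evaluation discards a partial assignment as early as possible. -/
theorem mem_standardHadamardCodes : ∀ a0 a1 a2 a3 a4 a5 : Bool,
    (a0.toNat + a1.toNat + a2.toNat + a3.toNat + a4.toNat + a5.toNat) % 3 = 0 →
    ∀ a6 a7 a8 : Bool,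
    (a0.toNat + a1.toNat + a2.toNat + a6.toNat + a7.toNat + a8.toNat) % 3 = 0 →
    ∀ a9 : Bool,
    (a0.toNat + a4.toNat + a5.toNat + a7.toNat + a8.toNat + a9.toNat) % 3 = 0 →
    ∀ a10 : Bool,
    (a0.toNat + a3.toNat + a5.toNat + a6.toNat + a8.toNat + a10.toNat) % 3 = 0 →
    ∀ a11 : Bool,
    (a0.toNat + a3.toNat + a4.toNat + a6.toNat + a7.toNat + a11.toNat) % 3 = 0 →
    (a1.toNat + a4.toNat + a5.toNat + a6.toNat + a8.toNat + a11.toNat) % 3 = 0 →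
    (a0.toNat + a1.toNat + a2.toNat + a3.toNat + a4.toNat + a5.toNat + a6.toNat + a7.toNat +
      a8.toNat + a9.toNat + a10.toNat + a11.toNat) % 6 = 0 →
    [a0, a1, a2, a3, a4, a5, a6, a7, a8, a9, a10, a11] ∈
      standardHadamardCodes.map fun n => (List.range 12).map n.testBit := by
  decide +kernel

/-- In #(A ∆ S) + 2 · #(A ∩ S) = #A + #S all the other terms are multiples of six. -/
theorem card_inter_mod_three {A S : Finset (Fin 12)} (hA : #A = 0 ∨ #A = 6 ∨ #A = 12)
    (hS : #S = 6) (h : #(A ∆ S) = 0 ∨ #(A ∆ S) = 6 ∨ #(A ∆ S) = 12) : #(A ∩ S) % 3 = 0 := by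
  have := card_symmDiff_add_two_mul_card_inter A S
  omega

theorem card_standardHadamardFamily_le : #standardHadamardFamily ≤ 24 := by
  let f : Finset (Fin 12) → List Bool := fun A => List.ofFn fun i => decide (i ∈ A)
  have hf : Function.Injective f := by
    intro A B hAB
    ext x
    simpa using congrFun (List.ofFn_injective hAB) x
  rw [← card_image_of_injective _ hf]
  refine (card_le_card (t := (standardHadamardCodes.map fun n =>
    (List.range 12).map n.testBit).toFinset) ?_).trans
    ((List.toFinset_card_le _).trans (by simp [standardHadamardCodes]))
  intro x hx
  obtain ⟨A, hA, rfl⟩ := mem_image.1 hx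
  rw [List.mem_toFinset]
  simp only [standardHadamardFamily, hadamardFamilyGenerators, mem_filter, mem_univ, true_and,
    List.forall_mem_cons] at hA
  obtain ⟨h0, h1, h2, h3, h4, h5, h6, -⟩ := hA
  have hc : #A = 0 ∨ #A = 6 ∨ #A = 12 := by
    simpa [← bot_eq_empty, symmDiff_bot] using h0
  have key : ∀ S : Finset (Fin 12), #(A ∩ S) = ∑ i ∈ S, (decide (i ∈ A)).toNat := by
    intro S
    rw [inter_comm, ← filter_mem_eq_inter, card_filter]
    refine sum_congr rfl fun i _ => ?_
    by_cases hi : i ∈ A <;> simp [hi]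
  have h1 := card_inter_mod_three hc (by rfl) h1
  have h2 := card_inter_mod_three hc (by rfl) h2
  have h3 := card_inter_mod_three hc (by rfl) h3
  have h4 := card_inter_mod_three hc (by rfl) h4
  have h5 := card_inter_mod_three hc (by rfl) h5
  have h6 := card_inter_mod_three hc (by rfl) h6
  have h7 : #(A ∩ univ) % 6 = 0 := by
    rw [inter_univ]
    omega
  rw [key] at h1 h2 h3 h4 h5 h6 h7
  rw [Fin.sum_univ_castSucc, Fin.sum_univ_castSucc, Fin.sum_univ_castSucc, Fin.sum_univ_castSucc,
    Fin.sum_univ_eight] at h7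
  have hfA : f A = [decide (0 ∈ A), decide (1 ∈ A), decide (2 ∈ A), decide (3 ∈ A),
      decide (4 ∈ A), decide (5 ∈ A), decide (6 ∈ A), decide (7 ∈ A), decide (8 ∈ A),
      decide (9 ∈ A), decide (10 ∈ A), decide (11 ∈ A)] := rfl
  rw [hfA]
  refine mem_standardHadamardCodes _ _ _ _ _ _ ?_ _ _ _ ?_ _ ?_ _ ?_ _ ?_ ?_ ?_
  · simpa [← add_assoc] using h1
  · simpa [← add_assoc] using h2
  · simpa [← add_assoc] using h3
  · simpa [← add_assoc] using h4
  · simpa [← add_assoc] using h5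
  · simpa [← add_assoc] using h6
  · exact h7

end

/-! ### Labelling the points by traces -/

open Finset in
theorem card_inter_inter_of_eq_singleton {α : Type*} [DecidableEq α] {A B T : Finset α} {i j : α}
    (hA : A ∩ T = {i}) (hB : B ∩ T = {j}) : #(A ∩ B ∩ T) = if i = j then 1 else 0 := by
  rw [inter_inter_distrib_right, hA, hB]
  split_ifs with h
  · simp [h]
  · rw [card_eq_zero, ← disjoint_iff_inter_eq_empty]
    simpa using h

open Finset in
theorem card_inter_inter_of_sdiff_eq_singleton {α : Type*} [DecidableEq α] {A B X : Finset α}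
    {i j : α} (hX : #X = 3) (hA : X \ A = {i}) (hB : X \ B = {j}) :
    #(A ∩ B ∩ X) = if i = j then 2 else 1 := by
  have h1 := card_sdiff_add_card_inter X (A ∩ B)
  rw [sdiff_inter_distrib_right, hA, hB, hX, inter_comm X] at h1
  split_ifs with h
  · subst h
    rw [union_self, card_singleton] at h1
    omega
  · rw [← insert_eq, card_pair h] at h1
    omega

/-- The traces of `A` on four triples: a point in the outer ones, a missing point in the inner
ones. -/
structure HasTraces (T X Y Z A : Finset (Fin 12)) (i j k l : Fin 12) : Prop where
  inter_T : A ∩ T = {i}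
  sdiff_X : X \ A = {j}
  sdiff_Y : Y \ A = {k}
  inter_Z : A ∩ Z = {l}

namespace IsTripleCells

open Finset

variable {F : Finset (Finset (Fin 12))} {T X Y Z : Finset (Fin 12)}

theorem exists_hasTraces (h : IsTripleCells F T X Y Z) (hF : IsHadamardFamily F)
    {A : Finset (Fin 12)} {i : Fin 12} (hA : A ∈ F) (hAT : A ∩ T = {i}) :
    ∃ j k l, HasTraces T X Y Z A i j k l := by
  obtain ⟨-, h2, h3, h4⟩ := h.card_inter_cells hF hA (by rw [hAT, card_singleton])
  have key : ∀ W, #W = 3 → #(A ∩ W) = 2 → ∃ j, W \ A = {j} := by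
    intro W hW hAW
    have := card_sdiff_add_card_inter W A
    rw [inter_comm] at this
    exact card_eq_one.1 (by omega)
  obtain ⟨j, hj⟩ := key X h.card_X h2
  obtain ⟨k, hk⟩ := key Y h.card_Y h3
  obtain ⟨l, hl⟩ := card_eq_one.1 h4
  exact ⟨j, k, l, hAT, hj, hk, hl⟩

/-- Pairs inside a triple share two points or one, according to whether their missing points
coincide. The equation therefore says that distinct words (i, j, k, l) agree in exactly one
coordinate, as in the tetracode. -/
theorem traces_agree (h : IsTripleCells F T X Y Z) (hF : IsHadamardFamily F)
    {A B : Finset (Fin 12)} {i j k l i' j' k' l' : Fin 12} (hA : A ∈ F) (hB : B ∈ F)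
    (hAt : HasTraces T X Y Z A i j k l) (hBt : HasTraces T X Y Z B i' j' k' l') (hne : A ≠ B) :
    (if i = i' then 1 else 0) + (if j = j' then 2 else 1) + (if k = k' then 2 else 1) +
      (if l = l' then 1 else 0) = 3 := by
  rw [← card_inter_inter_of_eq_singleton hAt.inter_T hBt.inter_T,
    ← card_inter_inter_of_eq_singleton hAt.inter_Z hBt.inter_Z,
    ← card_inter_inter_of_sdiff_eq_singleton h.card_X hAt.sdiff_X hBt.sdiff_X,
    ← card_inter_inter_of_sdiff_eq_singleton h.card_Y hAt.sdiff_Y hBt.sdiff_Y]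
  exact h.card_inter_of_ne hF hA (by rw [hAt.inter_T, card_singleton]) hB
    (by rw [hBt.inter_T, card_singleton]) hne

theorem eq_of_hasTraces (h : IsTripleCells F T X Y Z) {A : Finset (Fin 12)} {i j k l : Fin 12}
    (hA : HasTraces T X Y Z A i j k l) : A = {i} ∪ X \ {j} ∪ Y \ {k} ∪ {l} := by
  rw [← hA.inter_T, ← hA.sdiff_X, ← hA.sdiff_Y, ← hA.inter_Z]
  ext x
  have hx : x ∈ T ∪ X ∪ Y ∪ Z := h.union_eq ▸ mem_univ x
  simp only [mem_union, mem_inter, mem_sdiff] at hx ⊢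
  tauto

end IsTripleCells

open Finset in
theorem eq_triple_of_card {α : Type*} [DecidableEq α] {S : Finset α} {a b c : α} (hS : #S = 3)
    (ha : a ∈ S) (hb : b ∈ S) (hc : c ∈ S) (hab : a ≠ b) (hac : a ≠ c) (hbc : b ≠ c) :
    S = {a, b, c} := by
  refine (eq_of_subset_of_card_le ?_ ?_).symm
  · simp [insert_subset_iff, ha, hb, hc]
  · rw [hS, card_eq_three.2 ⟨a, b, c, hab, hac, hbc, rfl⟩]

open Finset in
theorem sdiff_singleton_eq_pair {α : Type*} [DecidableEq α] {S : Finset α} {a b c : α}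
    (hS : ∀ x, x ∈ S ↔ x = a ∨ x = b ∨ x = c) (hab : a ≠ b) (hac : a ≠ c) :
    S \ {a} = {b, c} := by
  ext x
  simp only [mem_sdiff, mem_insert, mem_singleton, hS]
  constructor
  · tauto
  · rintro (rfl | rfl)
    · exact ⟨Or.inr (Or.inl rfl), hab.symm⟩
    · exact ⟨Or.inr (Or.inr rfl), hac.symm⟩

namespace IsHadamardFamily

open Finset symmDiff

variable {F : Finset (Finset (Fin 12))}

/-- Pulled back along σ, the family is compatible with the generators and hence lies in the standard
one. It has 24 members and the standard one at most 24. -/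
theorem mem_iff_of_generators (hF : IsHadamardFamily F) (σ : Equiv.Perm (Fin 12))
    (h : ∀ S ∈ hadamardFamilyGenerators, S.map σ.toEmbedding ∈ F) (A : Finset (Fin 12)) :
    A.map σ.toEmbedding ∈ F ↔ A ∈ standardHadamardFamily := by
  have hsub : F.map (Equiv.finsetCongr σ.symm).toEmbedding ⊆ standardHadamardFamily := by
    intro B hB
    obtain ⟨A, hA, rfl⟩ := mem_map.1 hB
    simp only [standardHadamardFamily, mem_filter, mem_univ, true_and]
    intro S hS
    have := hF.card_symmDiff A hA _ (h S hS)
    have e : (A.map σ.symm.toEmbedding) ∆ S = (A ∆ S.map σ.toEmbedding).map σ.symm.toEmbedding := by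
      ext x
      simp [mem_symmDiff]
    simp only [Equiv.coe_toEmbedding, Equiv.finsetCongr_apply, e, card_map]
    exact this
  have heq := eq_of_subset_of_card_le hsub
    (by rw [card_map, hF.card_eq]; exact card_standardHadamardFamily_le)
  rw [← heq, mem_map_equiv]
  rfl

/-- The uniqueness of the Hadamard family, with three points and a fourth point off the blocks
through them prescribed. -/
theorem exists_perm (hF : IsHadamardFamily F) {p q r s : Fin 12} (hpq : p ≠ q) (hpr : p ≠ r)
    (hqr : q ≠ r) (hps : s ≠ p) (hqs : s ≠ q) (hrs : s ≠ r)
    (hs : ∀ B ∈ F, #B = 6 → p ∈ B → q ∈ B → r ∈ B → s ∉ B) :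
    ∃ σ : Equiv.Perm (Fin 12), σ 0 = p ∧ σ 1 = q ∧ σ 2 = r ∧ σ 9 = s ∧
      ∀ A : Finset (Fin 12), A.map σ.toEmbedding ∈ F ↔ A ∈ standardHadamardFamily := by
  have hT : #({p, q, r} : Finset (Fin 12)) = 3 := card_eq_three.2 ⟨p, q, r, hpq, hpr, hqr, rfl⟩
  obtain ⟨X, Y, Z, h⟩ := hF.exists_isTripleCells hT
  -- The only blocks through the triple are its unions with X and with Y, and s avoids both.
  have hsZ : s ∈ Z := by
    have hu : s ∈ {p, q, r} ∪ X ∪ Y ∪ Z := h.union_eq ▸ mem_univ s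
    have hb : ∀ W, #W = 3 → Disjoint {p, q, r} W → {p, q, r} ∪ W ∈ F → s ∉ W := by
      intro W hW hd hm hsW
      refine hs _ hm (by rw [card_union_of_disjoint hd, hT, hW]) ?_ ?_ ?_ ?_ <;> simp [hsW]
    have h1 := hb X h.card_X h.disj_TX h.mem_TX
    have h2 := hb Y h.card_Y h.disj_TY h.mem_TY
    simp only [mem_union, mem_insert, mem_singleton] at hu
    tauto
  have hp : p ∈ ({p, q, r} : Finset (Fin 12)) := by simp
  have hq : q ∈ ({p, q, r} : Finset (Fin 12)) := by simp
  obtain ⟨A₁, hA₁, t₁, z₁⟩ := h.exists_mem_of_traces_Z hF hp hsZ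
  obtain ⟨j₁, k₁, l₁, w₁⟩ := h.exists_hasTraces hF hA₁ t₁
  obtain rfl : s = l₁ := singleton_injective (z₁.symm.trans w₁.inter_Z)
  have memX : ∀ {A i j k l}, HasTraces {p, q, r} X Y Z A i j k l → j ∈ X := fun w =>
    (mem_sdiff.1 (w.sdiff_X ▸ mem_singleton_self _)).1
  have memY : ∀ {A i j k l}, HasTraces {p, q, r} X Y Z A i j k l → k ∈ Y := fun w =>
    (mem_sdiff.1 (w.sdiff_Y ▸ mem_singleton_self _)).1
  have memZ : ∀ {A i j k l}, HasTraces {p, q, r} X Y Z A i j k l → l ∈ Z := fun w =>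
    (mem_inter.1 (w.inter_Z ▸ mem_singleton_self _)).2
  -- A₄ starts at q and agrees with A₁ in X, so it differs from A₁ in Y and Z. Its point l₃ of Z,
  -- together with s, singles out l₂ as the third point of Z.
  obtain ⟨A₄, hA₄, t₄, x₄⟩ := h.exists_mem_of_traces_X hF hq (memX w₁)
  obtain ⟨j₄, k₄, l₃, w₄⟩ := h.exists_hasTraces hF hA₄ t₄
  obtain rfl : j₁ = j₄ := singleton_injective (x₄.symm.trans w₄.sdiff_X)
  have neT : ∀ {A B i j k l i' j' k' l'}, HasTraces {p, q, r} X Y Z A i j k l →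
      HasTraces {p, q, r} X Y Z B i' j' k' l' → i ≠ i' → A ≠ B := by
    rintro A B i j k l i' j' k' l' w w' hne rfl
    exact hne (singleton_injective (w.inter_T.symm.trans w'.inter_T))
  have neZ : ∀ {A B i j k l i' j' k' l'}, HasTraces {p, q, r} X Y Z A i j k l →
      HasTraces {p, q, r} X Y Z B i' j' k' l' → l ≠ l' → A ≠ B := by
    rintro A B i j k l i' j' k' l' w w' hne rfl
    exact hne (singleton_injective (w.inter_Z.symm.trans w'.inter_Z))
  have a14 := h.traces_agree hF hA₁ hA₄ w₁ w₄ (neT w₁ w₄ hpq)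
  have hk14 : k₁ ≠ k₄ := by
    rintro rfl
    simp only [if_neg hpq, if_true] at a14
    omega
  have hl13 : s ≠ l₃ := by
    rintro rfl
    simp [hpq, hk14] at a14
  obtain ⟨l₂, hl₂, hl2⟩ : ∃ l₂ ∈ Z, l₂ ∉ ({s, l₃} : Finset (Fin 12)) :=
    exists_mem_notMem_of_card_lt_card (lt_of_le_of_lt card_le_two (by rw [h.card_Z]; norm_num))
  simp only [mem_insert, mem_singleton, not_or] at hl2
  obtain ⟨A₂, hA₂, t₂, z₂⟩ := h.exists_mem_of_traces_Z hF hp hl₂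
  obtain ⟨j₂, k₂, l, w₂⟩ := h.exists_hasTraces hF hA₂ t₂
  obtain rfl : l₂ = l := singleton_injective (z₂.symm.trans w₂.inter_Z)
  obtain ⟨A₃, hA₃, t₃, z₃⟩ := h.exists_mem_of_traces_Z hF hp (memZ w₄)
  obtain ⟨j₃, k₃, l, w₃⟩ := h.exists_hasTraces hF hA₃ t₃
  obtain rfl : l₃ = l := singleton_injective (z₃.symm.trans w₃.inter_Z)
  -- Members through p already agree in T, so they differ in every other coordinate.
  have ne_of_agree : ∀ {A B j k l j' k' l'}, A ∈ F → B ∈ F →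
      HasTraces {p, q, r} X Y Z A p j k l → HasTraces {p, q, r} X Y Z B p j' k' l' → l ≠ l' →
      j ≠ j' ∧ k ≠ k' := by
    intro A B j k l j' k' l' hA hB w w' hne
    have := h.traces_agree hF hA hB w w' (neZ w w' hne)
    constructor <;> rintro rfl <;> simp [hne] at this <;> split_ifs at this
  obtain ⟨hj12, hk12⟩ := ne_of_agree hA₁ hA₂ w₁ w₂ (Ne.symm hl2.1)
  obtain ⟨hj13, hk13⟩ := ne_of_agree hA₁ hA₃ w₁ w₃ hl13
  obtain ⟨hj23, hk23⟩ := ne_of_agree hA₂ hA₃ w₂ w₃ hl2.2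
  have a24 := h.traces_agree hF hA₂ hA₄ w₂ w₄ (neT w₂ w₄ hpq)
  -- A₂ and A₄ differ in T, X and Z, so their single agreement is in Y. This places A₄ in the
  -- labelling.
  obtain rfl : k₂ = k₄ := by
    by_contra hne
    simp [hpq, hne, hl2.2, Ne.symm hj12] at a24
  have eX := eq_triple_of_card h.card_X (memX w₁) (memX w₂) (memX w₃) hj12 hj13 hj23
  have eY := eq_triple_of_card h.card_Y (memY w₁) (memY w₂) (memY w₃) hk12 hk13 hk23
  have eZ := eq_triple_of_card h.card_Z (memZ w₁) (memZ w₂) (memZ w₃) (Ne.symm hl2.1) hl13 hl2.2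
  let e : Fin 12 → Fin 12 := ![p, q, r, j₁, j₂, j₃, k₁, k₂, k₃, s, l₂, l₃]
  have he : Function.Surjective e := by
    intro x
    have hx : x ∈ {p, q, r} ∪ X ∪ Y ∪ Z := h.union_eq ▸ mem_univ x
    rw [eX, eY, eZ] at hx
    simp only [mem_union, mem_insert, mem_singleton] at hx
    rcases hx with ((((h | h | h) | (h | h | h)) | (h | h | h)) | (h | h | h))
    exacts [⟨0, h.symm⟩, ⟨1, h.symm⟩, ⟨2, h.symm⟩, ⟨3, h.symm⟩, ⟨4, h.symm⟩, ⟨5, h.symm⟩,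
      ⟨6, h.symm⟩, ⟨7, h.symm⟩, ⟨8, h.symm⟩, ⟨9, h.symm⟩, ⟨10, h.symm⟩, ⟨11, h.symm⟩]
  refine ⟨Equiv.ofBijective e ⟨Finite.injective_iff_surjective.2 he, he⟩, rfl, rfl, rfl, rfl,
    hF.mem_iff_of_generators _ ?_⟩
  have mX : ∀ x, x ∈ X ↔ x = j₁ ∨ x = j₂ ∨ x = j₃ := by simp [eX]
  have dX1 : X \ {j₁} = {j₂, j₃} := sdiff_singleton_eq_pair mX hj12 hj13
  have dX2 : X \ {j₂} = {j₁, j₃} := sdiff_singleton_eq_pair (fun x => (mX x).trans (by tauto)) hj12.symm hj23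
  have dX3 : X \ {j₃} = {j₁, j₂} := sdiff_singleton_eq_pair (fun x => (mX x).trans (by tauto)) hj13.symm hj23.symm
  have mY : ∀ x, x ∈ Y ↔ x = k₁ ∨ x = k₂ ∨ x = k₃ := by simp [eY]
  have dY1 : Y \ {k₁} = {k₂, k₃} := sdiff_singleton_eq_pair mY hk12 hk13
  have dY2 : Y \ {k₂} = {k₁, k₃} := sdiff_singleton_eq_pair (fun x => (mY x).trans (by tauto)) hk12.symm hk23
  have dY3 : Y \ {k₃} = {k₁, k₂} := sdiff_singleton_eq_pair (fun x => (mY x).trans (by tauto)) hk13.symm hk23.symm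
  have e₁ := h.eq_of_hasTraces w₁
  have e₂ := h.eq_of_hasTraces w₂
  have e₃ := h.eq_of_hasTraces w₃
  have e₄ := h.eq_of_hasTraces w₄
  have f₁ := h.mem_TX
  have f₂ := h.mem_TY
  rw [e₁, dX1, dY1] at hA₁
  rw [e₂, dX2, dY2] at hA₂
  rw [e₃, dX3, dY3] at hA₃
  rw [e₄, dX1, dY2] at hA₄
  rw [eX] at f₁
  rw [eY] at f₂
  simp only [hadamardFamilyGenerators, List.forall_mem_cons, List.not_mem_nil, false_imp_iff,
    implies_true, and_true, map_insert, map_singleton, map_empty]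
  simp only [singleton_union, insert_union] at f₁ f₂ hA₁ hA₂ hA₃ hA₄
  exact ⟨hF.empty_mem, f₁, f₂, hA₁, hA₂, hA₃, hA₄⟩

end IsHadamardFamily

/-! ### Weights of coset leaders -/

open Finset symmDiff in
-- Minimality against a block and against its complement gives #S - 3 ≤ #(B ∩ S) ≤ 3. For #S ≥ 5 the
-- intersection sizes i are 2 or 3, where C(i,2) + 3 = 2i; summing over the 22 blocks contradicts
-- the moments for #S = 5 and for #S = 6.
theorem IsHadamardFamily.card_le_four {F : Finset (Finset (Fin 12))} (hF : IsHadamardFamily F)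
    {S : Finset (Fin 12)} (hS : ∀ B ∈ F, #S ≤ #(S ∆ B)) : #S ≤ 4 := by
  have hk : ∀ B ∈ {B ∈ F | #B = 6}, #B = 6 := fun B hB => (mem_filter.1 hB).2
  have h2 : ∀ T : Finset (Fin 12), #T = 2 → #{B ∈ {B ∈ F | #B = 6} | T ⊆ B} = 5 := by
    intro T hT
    have := card_blocks_mul_eq _ 6 2 hk T
      (fun x hx => hF.card_blocks_through (by rw [card_insert_of_notMem hx, hT]))
    rw [hT, Fintype.card_fin] at this
    omega
  have h1 : ∀ T : Finset (Fin 12), #T = 1 → #{B ∈ {B ∈ F | #B = 6} | T ⊆ B} = 11 := by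
    intro T hT
    have := card_blocks_mul_eq _ 6 5 hk T
      (fun x hx => h2 _ (by rw [card_insert_of_notMem hx, hT]))
    rw [hT, Fintype.card_fin] at this
    omega
  have hle : ∀ B ∈ F, #B = 6 → #(B ∩ S) ≤ 3 := by
    intro B hB hB6
    have := card_symmDiff_add_two_mul_card_inter S B
    have := hS B hB
    rw [inter_comm]
    omega
  have hge : ∀ B ∈ F, #B = 6 → #S ≤ #(B ∩ S) + 3 := by
    intro B hB hB6
    have h3 := hle Bᶜ (hF.compl_mem B hB) (by rw [card_compl, hB6]; rfl)
    have h4 := card_sdiff_add_card_inter S B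
    rw [inter_comm, ← sdiff_eq_inter_compl] at h3
    rw [inter_comm S B] at h4
    omega
  by_contra! hcon
  have hub : #S ≤ 6 := by
    obtain ⟨B, hB⟩ := card_pos.1 (by rw [hF.card_blocks]; norm_num : 0 < #{B ∈ F | #B = 6})
    rw [mem_filter] at hB
    have := hle B hB.1 hB.2
    have := hge B hB.1 hB.2
    omega
  have s1 := sum_choose_card_inter {B ∈ F | #B = 6} S 1 11 (fun T _ hT => h1 T hT)
  have s2 := sum_choose_card_inter {B ∈ F | #B = 6} S 2 5 (fun T _ hT => h2 T hT)
  have s0 : ∑ _B ∈ F with #_B = 6, 1 = 22 := by rw [← card_eq_sum_ones, hF.card_blocks]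
  have key : ∑ B ∈ F with #B = 6, ((#(B ∩ S)).choose 2 + 3 * 1) =
      ∑ B ∈ F with #B = 6, 2 * (#(B ∩ S)).choose 1 := by
    refine sum_congr rfl fun B hB => ?_
    rw [mem_filter] at hB
    have := hle B hB.1 hB.2
    have := hge B hB.1 hB.2
    obtain h | h : #(B ∩ S) = 2 ∨ #(B ∩ S) = 3 := by omega
    · rw [h]; rfl
    · rw [h]; rfl
  rw [sum_add_distrib, ← mul_sum, ← mul_sum, s0, s1, s2] at key
  obtain h | h : #S = 5 ∨ #S = 6 := by omega
  · rw [h] at key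
    norm_num [Nat.choose] at key
  · rw [h] at key
    norm_num [Nat.choose] at key

open Finset in
theorem IsHadamardFamily.exists_perm_of_triple {F : Finset (Finset (Fin 12))}
    (hF : IsHadamardFamily F) {p q r : Fin 12} (hpq : p ≠ q) (hpr : p ≠ r) (hqr : q ≠ r) :
    ∃ σ : Equiv.Perm (Fin 12), σ 0 = p ∧ σ 1 = q ∧ σ 2 = r ∧
      ∀ A : Finset (Fin 12), A.map σ.toEmbedding ∈ F ↔ A ∈ standardHadamardFamily := by
  have hT : #({p, q, r} : Finset (Fin 12)) = 3 := card_eq_three.2 ⟨p, q, r, hpq, hpr, hqr, rfl⟩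
  obtain ⟨X, Y, Z, h⟩ := hF.exists_isTripleCells hT
  obtain ⟨s, hs⟩ := card_pos.1 (by rw [h.card_Z]; norm_num : 0 < #Z)
  have hsT := disjoint_right.1 h.disj_TZ hs
  have hsX := disjoint_right.1 h.disj_XZ hs
  have hsY := disjoint_right.1 h.disj_YZ hs
  have hsT' := hsT
  simp only [mem_insert, mem_singleton, not_or] at hsT'
  obtain ⟨σ, h0, h1, h2, -, h4⟩ := hF.exists_perm hpq hpr hqr hsT'.1 hsT'.2.1 hsT'.2.2 (by
    intro B hB hB6 hp hq hr hsB
    rcases h.eq_or_eq B hB hB6 (by simp [insert_subset_iff, hp, hq, hr]) with rfl | rfl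
    · exact (mem_union.1 hsB).elim hsT hsX
    · exact (mem_union.1 hsB).elim hsT hsY)
  exact ⟨σ, h0, h1, h2, h4⟩

/-! ### Vertices as sets, codes as set families -/

/-- The set of entries in which two vertices differ. -/
def diffSet {m : ℕ} (α β : HammingVertex m) : Finset (Fin m) := {i | α i ≠ β i}

section diffSet

open Finset symmDiff

variable {m : ℕ}

theorem mem_diffSet {α β : HammingVertex m} {i : Fin m} : i ∈ diffSet α β ↔ α i ≠ β i := by
  simp [diffSet]

theorem card_diffSet (α β : HammingVertex m) : #(diffSet α β) = hammingDist α β := rfl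

@[simp] theorem diffSet_self (α : HammingVertex m) : diffSet α α = ∅ := by
  ext i
  simp [mem_diffSet]

theorem diffSet_symmDiff (α β γ : HammingVertex m) :
    diffSet α β ∆ diffSet α γ = diffSet β γ := by
  ext i
  simp only [mem_symmDiff, mem_diffSet]
  generalize α i = a
  generalize β i = b
  generalize γ i = c
  revert a b c
  decide

theorem hammingDist_eq_card_symmDiff (α β γ : HammingVertex m) :
    hammingDist β γ = #(diffSet α β ∆ diffSet α γ) := by
  rw [diffSet_symmDiff, card_diffSet]

theorem diffSet_injective (α : HammingVertex m) : Function.Injective (diffSet α) := by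
  intro β γ h
  have := diffSet_symmDiff α β γ
  rw [h, symmDiff_self, eq_comm, bot_eq_empty, ← card_eq_zero, card_diffSet] at this
  exact hammingDist_eq_zero.1 this

/-- The vertex differing from `α` in the entries of `S`. -/
def flipVertex (α : HammingVertex m) (S : Finset (Fin m)) : HammingVertex m :=
  fun i => if i ∈ S then α i + 1 else α i

@[simp] theorem diffSet_flipVertex (α : HammingVertex m) (S : Finset (Fin m)) :
    diffSet α (flipVertex α S) = S := by
  ext i
  simp only [mem_diffSet, flipVertex]
  split_ifs with h <;> simp [h]

theorem flipVertex_diffSet (α β : HammingVertex m) : flipVertex α (diffSet α β) = β :=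
  diffSet_injective α (by simp)

theorem diffSet_add_one (α β : HammingVertex m) : diffSet α (β + 1) = (diffSet α β)ᶜ := by
  ext i
  simp only [mem_compl, mem_diffSet, Pi.add_apply, Pi.one_apply]
  generalize α i = a
  generalize β i = b
  revert a b
  decide

theorem hammingDist_add_one (α β : HammingVertex m) :
    hammingDist α (β + 1) + hammingDist α β = m := by
  rw [← card_diffSet, ← card_diffSet, diffSet_add_one, card_compl, Fintype.card_fin]
  have := card_le_univ (diffSet α β)
  rw [Fintype.card_fin] at this
  omega

theorem eq_add_one_of_hammingDist_eq {α β : HammingVertex m} (h : hammingDist α β = m) :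
    β = α + 1 := by
  apply diffSet_injective α
  rw [diffSet_add_one, diffSet_self, compl_empty, ← card_eq_iff_eq_univ, card_diffSet, h,
    Fintype.card_fin]

/-- The supports of the codewords, after translating `α` to zero. -/
def codeFamily (C : BinaryCode m) (α : HammingVertex m) : Finset (Finset (Fin m)) :=
  C.image (diffSet α)

theorem mem_codeFamily {C : BinaryCode m} {α : HammingVertex m} {B : Finset (Fin m)} :
    B ∈ codeFamily C α ↔ ∃ β ∈ C, diffSet α β = B := mem_image

theorem card_codeFamily (C : BinaryCode m) (α : HammingVertex m) : #(codeFamily C α) = #C :=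
  card_image_of_injective _ (diffSet_injective α)

theorem card_filter_hammingDist (C : BinaryCode m) (α γ : HammingVertex m) (k : ℕ) :
    #{β ∈ C | hammingDist γ β = k} = #{B ∈ codeFamily C α | #(diffSet α γ ∆ B) = k} := by
  rw [codeFamily, filter_image, card_image_of_injective _ (diffSet_injective α)]
  simp_rw [hammingDist_eq_card_symmDiff α γ]

theorem empty_mem_codeFamily {C : BinaryCode m} {α : HammingVertex m} (hα : α ∈ C) :
    ∅ ∈ codeFamily C α := mem_codeFamily.2 ⟨α, hα, by simp⟩

theorem card_symmDiff_codeFamily {C : BinaryCode m} {δ : ℕ} (hC : HasMinDistance C δ)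
    {α : HammingVertex m} {A B : Finset (Fin m)} (hA : A ∈ codeFamily C α)
    (hB : B ∈ codeFamily C α) (hne : A ≠ B) : δ ≤ #(A ∆ B) := by
  obtain ⟨β, hβ, rfl⟩ := mem_codeFamily.1 hA
  obtain ⟨γ, hγ, rfl⟩ := mem_codeFamily.1 hB
  rw [← hammingDist_eq_card_symmDiff]
  exact hC.2 ⟨β, hβ, γ, hγ, fun h => hne (by rw [h]), rfl⟩

theorem distToCode_le {C : BinaryCode m} {α γ : HammingVertex m} (hα : α ∈ C) :
    distToCode C γ ≤ hammingDist γ α := Nat.sInf_le ⟨α, hα, rfl⟩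

theorem exists_hammingDist_eq_distToCode {C : BinaryCode m} (hC : C.Nonempty)
    (γ : HammingVertex m) : ∃ α ∈ C, hammingDist γ α = distToCode C γ := by
  obtain ⟨α, hα⟩ := hC
  exact Nat.sInf_mem (s := {d : ℕ | ∃ β ∈ C, hammingDist γ β = d}) ⟨_, α, hα, rfl⟩

theorem distToCode_eq {C : BinaryCode m} {α γ : HammingVertex m} (hα : α ∈ C)
    (h : ∀ B ∈ codeFamily C α, #(diffSet α γ) ≤ #(diffSet α γ ∆ B)) :
    distToCode C γ = #(diffSet α γ) := by
  apply le_antisymm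
  · rw [card_diffSet, hammingDist_comm]
    exact distToCode_le hα
  · obtain ⟨β, hβ, e⟩ := exists_hammingDist_eq_distToCode ⟨α, hα⟩ γ
    rw [← e, hammingDist_eq_card_symmDiff α]
    exact h _ (mem_codeFamily.2 ⟨β, hβ, rfl⟩)

theorem distToCode_eq_zero {C : BinaryCode m} {α : HammingVertex m} (hα : α ∈ C) :
    distToCode C α = 0 := by
  rw [distToCode_eq hα (by simp)]
  simp

/-- Regularity on the cell C₀: all codewords see the same distance distribution. -/
theorem IsCompletelyRegular.exists_hammingDist_eq {C : BinaryCode m}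
    (hC : IsCompletelyRegular C) {α β γ : HammingVertex m} (hα : α ∈ C) (hβ : β ∈ C)
    (hγ : γ ∈ C) : ∃ δ ∈ C, hammingDist γ δ = hammingDist α β := by
  have h := hC 0 (hammingDist α β) α (distToCode_eq_zero hα) γ (distToCode_eq_zero hγ)
  have hpos : 0 < #{δ ∈ C | hammingDist α δ = hammingDist α β} :=
    card_pos.2 ⟨β, mem_filter.2 ⟨hβ, rfl⟩⟩
  rw [h] at hpos
  obtain ⟨δ, hδ⟩ := card_pos.1 hpos
  exact ⟨δ, (mem_filter.1 hδ).1, (mem_filter.1 hδ).2⟩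

/-- In a completely regular code, the sets of size `n` all at distance `n` from the translated
code see the same number of supports at a given distance. -/
theorem IsCompletelyRegular.card_filter_codeFamily {C : BinaryCode m}
    (hC : IsCompletelyRegular C) {α : HammingVertex m} (hα : α ∈ C) {n : ℕ}
    (h : ∀ S : Finset (Fin m), #S = n → ∀ B ∈ codeFamily C α, n ≤ #(S ∆ B)) (k : ℕ)
    {S S' : Finset (Fin m)} (hS : #S = n) (hS' : #S' = n) :
    #{B ∈ codeFamily C α | #(S ∆ B) = k} = #{B ∈ codeFamily C α | #(S' ∆ B) = k} := by
  have key : ∀ S, #S = n → flipVertex α S ∈ distCell C n := by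
    intro S hS
    change distToCode C _ = n
    rw [distToCode_eq hα (by rw [diffSet_flipVertex, hS]; exact h S hS), diffSet_flipVertex, hS]
  have := hC n k _ (key S hS) _ (key S' hS')
  rw [card_filter_hammingDist C α, card_filter_hammingDist C α] at this
  simpa using this

end diffSet

/-- The binary Hadamard codes of length twelve, described by their distances. -/
structure IsHadamardLike (C : BinaryCode 12) : Prop where
  card_eq : C.card = 24
  add_one_mem : ∀ α ∈ C, α + 1 ∈ C
  hammingDist_mem : ∀ α ∈ C, ∀ β ∈ C,
    hammingDist α β = 0 ∨ hammingDist α β = 6 ∨ hammingDist α β = 12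

theorem IsHadamardLike.isHadamardFamily {C : BinaryCode 12} (hC : IsHadamardLike C)
    {α : HammingVertex 12} (hα : α ∈ C) : IsHadamardFamily (codeFamily C α) where
  empty_mem := empty_mem_codeFamily hα
  compl_mem := by
    intro A hA
    obtain ⟨β, hβ, rfl⟩ := mem_codeFamily.1 hA
    exact mem_codeFamily.2 ⟨β + 1, hC.add_one_mem β hβ, diffSet_add_one α β⟩
  card_symmDiff := by
    intro A hA B hB
    obtain ⟨β, hβ, rfl⟩ := mem_codeFamily.1 hA
    obtain ⟨γ, hγ, rfl⟩ := mem_codeFamily.1 hB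
    rw [← hammingDist_eq_card_symmDiff]
    exact hC.hammingDist_mem β hβ γ hγ
  card_eq := by rw [card_codeFamily, hC.card_eq]

/-- The distances from α to β and to its antipode add up to m, and each is zero or at least δ. -/
theorem HasMinDistance.hammingDist_add_one_cases {m δ : ℕ} {C : BinaryCode m}
    (hC : HasMinDistance C δ) (h1 : ∀ α ∈ C, α + 1 ∈ C) {α β : HammingVertex m} (hα : α ∈ C)
    (hβ : β ∈ C) : hammingDist α β = 0 ∨ hammingDist α β = m ∨
      (δ ≤ hammingDist α β ∧ hammingDist α β + δ ≤ m) := by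
  have hs := hammingDist_add_one α β
  by_cases h : α = β
  · exact Or.inl (hammingDist_eq_zero.2 h)
  by_cases h' : α = β + 1
  · right; left
    rw [hammingDist_eq_zero.2 h'] at hs
    omega
  · have := hC.2 ⟨α, hα, β, hβ, h, rfl⟩
    have := hC.2 ⟨α, hα, β + 1, h1 β hβ, h', rfl⟩
    omega

/-- The antipode is the only vertex at distance m, so one antipodal pair of codewords provides an
antipode for every codeword. -/
theorem IsCompletelyRegular.add_one_mem {m : ℕ} {C : BinaryCode m} (hC : IsCompletelyRegular C)
    {α β : HammingVertex m} (hα : α ∈ C) (hβ : β ∈ C) (hαβ : hammingDist α β = m) :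
    ∀ γ ∈ C, γ + 1 ∈ C := by
  intro γ hγ
  obtain ⟨δ, hδ, e⟩ := hC.exists_hammingDist_eq hα hβ hγ
  rw [hαβ] at e
  exact eq_add_one_of_hammingDist_eq e ▸ hδ

open Finset symmDiff in
-- Within half the minimum distance of a codeword no other codeword is nearer. All n-sets thus lie
-- in the cell C_n, where regularity compares them.
theorem le_card_symmDiff_of_le {α : Type*} [DecidableEq α] {A B : Finset α} {n δ : ℕ}
    (hA : #A = n) (hδ : 2 * n ≤ δ) (hB : B = ∅ ∨ δ ≤ #B) : n ≤ #(A ∆ B) := by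
  have h := card_symmDiff_add_two_mul_card_inter A B
  have h1 := card_le_card (inter_subset_left : A ∩ B ⊆ A)
  rcases hB with rfl | hB
  · rw [inter_empty, card_empty] at h
    omega
  · omega

open Finset in
theorem subset_of_card_le_card_inter {α : Type*} [DecidableEq α] {A B : Finset α}
    (h : #A ≤ #(A ∩ B)) : A ⊆ B :=
  inter_eq_left.1 (eq_of_subset_of_card_le inter_subset_left h)

section

open Finset symmDiff

theorem HasMinDistance.eq_empty_or_le_card {m δ : ℕ} {C : BinaryCode m}
    (hC : HasMinDistance C δ) {α : HammingVertex m} (hα : α ∈ C) {B : Finset (Fin m)}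
    (hB : B ∈ codeFamily C α) : B = ∅ ∨ δ ≤ #B := by
  by_cases h : B = ∅
  · exact Or.inl h
  · right
    have := card_symmDiff_codeFamily hC hB (empty_mem_codeFamily hα) h
    rwa [← bot_eq_empty, symmDiff_bot] at this

theorem isHadamardLike_of_isCompletelyRegular {C : BinaryCode 12} (hC : IsCompletelyRegular C)
    (hδ : HasMinDistance C 6) : IsHadamardLike C := by
  obtain ⟨α, hα, β, hβ, -, hαβ⟩ := hδ.1
  set F := codeFamily C α with hF
  have hw : ∀ B ∈ F, B = ∅ ∨ 6 ≤ #B := fun B hB => hδ.eq_empty_or_le_card hα hB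
  -- The extra 1 is the zero word; any other word at distance 3 from S has weight 6 and contains S.
  have hcount : ∀ S : Finset (Fin 12), #S = 3 →
      #{B ∈ F | #(S ∆ B) = 3} = 1 + #{B ∈ {B ∈ F | #B = 6} | S ⊆ B} := by
    intro S hS
    have e : ({B ∈ F | #(S ∆ B) = 3} : Finset _) =
        insert ∅ {B ∈ {B ∈ F | #B = 6} | S ⊆ B} := by
      ext B
      simp only [mem_filter, mem_insert]
      have h := card_symmDiff_add_two_mul_card_inter S B
      constructor
      · rintro ⟨hB, h3⟩
        rcases hw B hB with h0 | h6
        · exact Or.inl h0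
        · have := card_le_card (inter_subset_left : S ∩ B ⊆ S)
          exact Or.inr ⟨⟨hB, by omega⟩, subset_of_card_le_card_inter (by omega)⟩
      · rintro (rfl | ⟨⟨hB, h6⟩, hSB⟩)
        · refine ⟨empty_mem_codeFamily hα, ?_⟩
          rw [inter_empty, card_empty] at h
          omega
        · rw [inter_eq_left.2 hSB] at h
          exact ⟨hB, by omega⟩
    rw [e, card_insert_of_notMem (by simp), add_comm]
  have hB : diffSet α β ∈ ({B ∈ F | #B = 6} : Finset _) :=
    mem_filter.2 ⟨mem_codeFamily.2 ⟨β, hβ, rfl⟩, hαβ⟩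
  obtain ⟨h22, hcompl⟩ := three_design_twelve {B ∈ F | #B = 6} (fun B hB => (mem_filter.1 hB).2)
    ⟨_, hB⟩ (by
      intro A hA B hB hne
      rw [mem_filter] at hA hB
      have := card_symmDiff_codeFamily hδ hA.1 hB.1 hne
      have := card_symmDiff_add_two_mul_card_inter A B
      omega)
    #{B ∈ {B ∈ F | #B = 6} | {0, 1, 2} ⊆ B} (by
      intro T hT
      have h1 := hcount T hT
      have h2 := hcount {0, 1, 2} rfl
      have h3 := hC.card_filter_codeFamily hα (n := 3) (fun S hS B hB =>
        le_card_symmDiff_of_le hS le_rfl (hw B hB)) 3 hT (S' := {0, 1, 2}) rfl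
      rw [← hF] at h3
      omega)
  have hB' := hcompl _ hB
  rw [mem_filter, mem_codeFamily] at hB'
  obtain ⟨⟨γ, hγ, e⟩, -⟩ := hB'
  have h1 : ∀ α ∈ C, α + 1 ∈ C := by
    refine hC.add_one_mem hβ hγ ?_
    rw [hammingDist_eq_card_symmDiff α, e, symmDiff_compl_self]
    rfl
  have hd : ∀ α ∈ C, ∀ β ∈ C,
      hammingDist α β = 0 ∨ hammingDist α β = 6 ∨ hammingDist α β = 12 := by
    intro α hα β hβ
    have := hδ.hammingDist_add_one_cases h1 hα hβ
    omega
  refine ⟨?_, h1, hd⟩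
  have hFe : F = insert ∅ (insert univ {B ∈ F | #B = 6}) := by
    ext B
    simp only [mem_insert, mem_filter]
    constructor
    · intro hB
      obtain ⟨γ, hγ, rfl⟩ := mem_codeFamily.1 hB
      rcases hd α hα γ hγ with h | h | h
      · exact Or.inl (card_eq_zero.1 h)
      · exact Or.inr (Or.inr ⟨hB, h⟩)
      · exact Or.inr (Or.inl ((card_eq_iff_eq_univ _).1 h))
    · rintro (rfl | rfl | h)
      · exact empty_mem_codeFamily hα
      · exact mem_codeFamily.2 ⟨α + 1, h1 α hα, by simp [diffSet_add_one]⟩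
      · exact h.1
  rw [← card_codeFamily C α, ← hF, hFe, card_insert_of_notMem, card_insert_of_notMem, h22]
  · simp
  · simp only [mem_insert, mem_filter, card_empty]
    rintro (h | h)
    · simpa using congrArg card h
    · omega

theorem sum_add_sum_eq_hammingDist {m : ℕ} (α β : HammingVertex m) :
    ∑ i, α i + ∑ i, β i = (hammingDist α β : ZMod 2) := by
  rw [← sum_add_distrib, ← card_diffSet, diffSet, card_filter, Nat.cast_sum]
  refine sum_congr rfl fun i _ => ?_
  generalize α i = a
  generalize β i = b
  revert a b
  decide

/-- The extension of a vertex by an overall parity entry. -/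
def parityExtension {m : ℕ} (α : HammingVertex m) : HammingVertex (m + 1) :=
  Fin.cons (∑ i, α i) α

theorem hammingDist_cons {m : ℕ} (a b : ZMod 2) (α β : HammingVertex m) :
    hammingDist (Fin.cons a α : HammingVertex (m + 1)) (Fin.cons b β) =
      (if a = b then 0 else 1) + hammingDist α β := by
  rw [← card_diffSet, ← card_diffSet, diffSet, diffSet, card_filter, card_filter,
    Fin.sum_univ_succ]
  simp

theorem hammingDist_parityExtension {m : ℕ} (α β : HammingVertex m) :
    hammingDist (parityExtension α) (parityExtension β) =
      hammingDist α β + hammingDist α β % 2 := by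
  rw [parityExtension, parityExtension, hammingDist_cons, add_comm]
  congr 1
  have h := sum_add_sum_eq_hammingDist α β
  rcases Nat.mod_two_eq_zero_or_one (hammingDist α β) with h2 | h2
  · rw [h2, if_pos]
    rw [(ZMod.natCast_eq_zero_iff_even).2 (Nat.even_iff.2 h2)] at h
    exact CharTwo.add_eq_zero.1 h
  · rw [h2, if_neg]
    rw [(ZMod.natCast_eq_one_iff_odd).2 (Nat.odd_iff.2 h2)] at h
    intro e
    rw [e, CharTwo.add_self_eq_zero] at h
    exact zero_ne_one h

/-- Complementing changes the parity entry because the length 11 is odd. -/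
theorem parityExtension_add_one (α : HammingVertex 11) :
    parityExtension (α + 1) = parityExtension α + 1 := by
  funext i
  refine Fin.cases ?_ (fun j => ?_) i
  · simp only [parityExtension, Fin.cons_zero, Pi.add_apply, Pi.one_apply, sum_add_distrib]
    congr 1
  · simp [parityExtension]

theorem puncturedCode_parityExtension (C : BinaryCode 11) :
    puncturedCode 0 (C.image parityExtension) = C := by
  rw [puncturedCode, image_image]
  have h : ((fun (α : HammingVertex 12) (j : Fin 11) => α (Fin.succAbove 0 j)) ∘ parityExtension) =
      (id : HammingVertex 11 → HammingVertex 11) := by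
    funext α j
    simp [parityExtension]
  rw [h, image_id]

theorem exists_isHadamardLike_of_isCompletelyRegular {C : BinaryCode 11}
    (hC : IsCompletelyRegular C) (hδ : HasMinDistance C 5) :
    ∃ E : BinaryCode 12, IsHadamardLike E ∧ C = puncturedCode 0 E := by
  obtain ⟨α, hα, β, hβ, -, hαβ⟩ := hδ.1
  set F := codeFamily C α with hF
  have hw : ∀ B ∈ F, B = ∅ ∨ 5 ≤ #B := fun B hB => hδ.eq_empty_or_le_card hα hB
  -- The zero word is at distance 2 from S, so distance 3 sees only the weight-5 words containing S.
  have hcount : ∀ S : Finset (Fin 11), #S = 2 →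
      ({B ∈ F | #(S ∆ B) = 3} : Finset _) = {B ∈ {B ∈ F | #B = 5} | S ⊆ B} := by
    intro S hS
    ext B
    simp only [mem_filter]
    have h := card_symmDiff_add_two_mul_card_inter S B
    constructor
    · rintro ⟨hB, h3⟩
      rcases hw B hB with rfl | h5
      · rw [inter_empty, card_empty] at h
        omega
      · have := card_le_card (inter_subset_left : S ∩ B ⊆ S)
        exact ⟨⟨hB, by omega⟩, subset_of_card_le_card_inter (by omega)⟩
    · rintro ⟨⟨hB, h6⟩, hSB⟩
      rw [inter_eq_left.2 hSB] at h
      exact ⟨hB, by omega⟩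
  have hB : diffSet α β ∈ ({B ∈ F | #B = 5} : Finset _) :=
    mem_filter.2 ⟨mem_codeFamily.2 ⟨β, hβ, rfl⟩, hαβ⟩
  have hk : ∀ B ∈ ({B ∈ F | #B = 5} : Finset _), #B = 5 := fun B hB => (mem_filter.1 hB).2
  have hI : ∀ B ∈ ({B ∈ F | #B = 5} : Finset _), ∀ B' ∈ ({B ∈ F | #B = 5} : Finset _), B ≠ B' →
      #(B ∩ B') ≤ 2 := by
    intro A hA B hB hne
    rw [mem_filter] at hA hB
    have := card_symmDiff_codeFamily hδ hA.1 hB.1 hne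
    have := card_symmDiff_add_two_mul_card_inter A B
    omega
  obtain ⟨h11, hd1, hd2⟩ := two_design_eleven {B ∈ F | #B = 5} hk ⟨_, hB⟩ hI
    #{B ∈ {B ∈ F | #B = 5} | {0, 1} ⊆ B} (by
      intro T hT
      rw [← hcount T hT, ← hcount {0, 1} rfl]
      exact hC.card_filter_codeFamily hα (n := 2) (fun S hS B hB =>
        le_card_symmDiff_of_le hS (by norm_num) (hw B hB)) 3 hT (S' := {0, 1}) rfl)
  have hcompl : ∀ W ∈ F, #W = 6 → Wᶜ ∈ ({B ∈ F | #B = 5} : Finset _) := by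
    intro W hW hW6
    refine compl_mem_biplane_of_card_inter_le _ hk h11 hd1 hd2 W hW6 fun B hB => ?_
    have h5 := hk B hB
    have := card_symmDiff_codeFamily hδ (mem_filter.1 hB).1 hW (by
      rintro rfl
      omega)
    have := card_symmDiff_add_two_mul_card_inter B W
    omega
  -- Two blocks of the biplane through a common pair meet in exactly that pair, hence are at
  -- distance 5 + 5 - 4 = 6. Regularity then yields a word of weight 6, whose complement is a block:
  -- an antipodal pair.
  obtain ⟨γ, hγ, h6⟩ : ∃ γ ∈ C, hammingDist β γ = 6 := by
    obtain ⟨P, hPB, hP⟩ := exists_subset_card_eq (s := diffSet α β) (n := 2)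
      (by rw [hk _ hB]; norm_num)
    obtain ⟨B', hB', hne⟩ := exists_mem_ne (s := {B ∈ {B ∈ F | #B = 5} | P ⊆ B})
      (by rw [hd2 P hP]; norm_num) (diffSet α β)
    rw [mem_filter] at hB'
    have h1 := hI _ hB _ hB'.1 hne.symm
    have h2 := card_le_card (subset_inter hPB hB'.2)
    have h3 := card_symmDiff_add_two_mul_card_inter (diffSet α β) B'
    rw [hk _ hB, hk _ hB'.1] at h3
    obtain ⟨γ, hγ, rfl⟩ := mem_codeFamily.1 (mem_filter.1 hB'.1).1
    refine ⟨γ, hγ, ?_⟩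
    rw [hammingDist_eq_card_symmDiff α]
    omega
  obtain ⟨δ, hδC, e6⟩ := hC.exists_hammingDist_eq hβ hγ hα
  rw [h6] at e6
  have hm := (mem_filter.1 (hcompl _ (mem_codeFamily.2 ⟨δ, hδC, rfl⟩) e6)).1
  obtain ⟨ε, hε, e⟩ := mem_codeFamily.1 hm
  have h1 : ∀ α ∈ C, α + 1 ∈ C := by
    refine hC.add_one_mem hδC hε ?_
    rw [hammingDist_eq_card_symmDiff α, e, symmDiff_compl_self]
    rfl
  have hd : ∀ α ∈ C, ∀ β ∈ C, hammingDist α β = 0 ∨ hammingDist α β = 5 ∨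
      hammingDist α β = 6 ∨ hammingDist α β = 11 := by
    intro α hα β hβ
    have := hδ.hammingDist_add_one_cases h1 hα hβ
    omega
  have hcF : ∀ B ∈ F, Bᶜ ∈ F := by
    intro B hB
    obtain ⟨γ, hγ, rfl⟩ := mem_codeFamily.1 hB
    exact mem_codeFamily.2 ⟨γ + 1, h1 γ hγ, diffSet_add_one _ _⟩
  have h66 : #{B ∈ F | #B = 6} = 11 := by
    refine Eq.trans ?_ h11
    apply card_nbij' (fun A => Aᶜ) (fun A => Aᶜ)
    · intro B hB
      simp only [coe_filter, Set.mem_ofPred_eq] at hB ⊢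
      exact ⟨hcF B hB.1, by rw [card_compl, hB.2]; rfl⟩
    · intro B hB
      simp only [coe_filter, Set.mem_ofPred_eq] at hB ⊢
      exact ⟨hcF B hB.1, by rw [card_compl, hB.2]; rfl⟩
    · intro B _
      simp
    · intro B _
      simp
  have hFe : F = insert ∅ (insert univ ({B ∈ F | #B = 5} ∪ {B ∈ F | #B = 6})) := by
    ext B
    simp only [mem_insert, mem_union, mem_filter]
    constructor
    · intro hB
      obtain ⟨γ, hγ, rfl⟩ := mem_codeFamily.1 hB
      rcases hd α hα γ hγ with h | h | h | h
      · exact Or.inl (card_eq_zero.1 h)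
      · exact Or.inr (Or.inr (Or.inl ⟨hB, h⟩))
      · exact Or.inr (Or.inr (Or.inr ⟨hB, h⟩))
      · exact Or.inr (Or.inl ((card_eq_iff_eq_univ _).1 h))
    · rintro (rfl | rfl | h | h)
      · exact empty_mem_codeFamily hα
      · exact mem_codeFamily.2 ⟨α + 1, h1 α hα, by simp [diffSet_add_one]⟩
      · exact h.1
      · exact h.1
  have h24 : #C = 24 := by
    rw [← card_codeFamily C α, ← hF, hFe, card_insert_of_notMem, card_insert_of_notMem,
      card_union_of_disjoint, h11, h66]
    · rw [disjoint_left]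
      intro B hB hB'
      rw [mem_filter] at hB hB'
      omega
    · simp
    · simp only [mem_insert, mem_union, mem_filter, card_empty]
      rintro (h | h | h)
      · simpa using congrArg card h
      · omega
      · omega
  refine ⟨C.image parityExtension, ⟨?_, ?_, ?_⟩, (puncturedCode_parityExtension C).symm⟩
  · rw [card_image_of_injective, h24]
    intro α β h
    exact (Fin.cons_inj.1 h).2
  · intro α' h
    obtain ⟨α, hα, rfl⟩ := mem_image.1 h
    exact mem_image.2 ⟨α + 1, h1 α hα, parityExtension_add_one α⟩
  · intro α' h β' h'
    obtain ⟨α, hα, rfl⟩ := mem_image.1 h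
    obtain ⟨β, hβ, rfl⟩ := mem_image.1 h'
    rw [hammingDist_parityExtension]
    rcases hd α hα β hβ with h | h | h | h <;> simp [h]

end

/-! ### Codes of Hadamard matrices -/

open Finset in
theorem sum_mul_eq_sub_two_mul_hammingDist {m : ℕ} (u v : Fin m → ℤ)
    (hu : ∀ i, u i = 1 ∨ u i = -1) (hv : ∀ i, v i = 1 ∨ v i = -1) :
    ∑ i, u i * v i = m - 2 * hammingDist (signToBinary u) (signToBinary v) := by
  have h : ∀ i, u i * v i =
      1 - 2 * ((if signToBinary u i ≠ signToBinary v i then 1 else 0 : ℕ) : ℤ) := by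
    intro i
    rcases hu i with h | h <;> rcases hv i with h' | h' <;> simp [signToBinary, h, h']
  rw [← card_diffSet, diffSet, card_filter, Nat.cast_sum, mul_sum, sum_congr rfl fun i _ => h i,
    sum_sub_distrib]
  simp

section

open Finset

theorem Matrix.IsHadamard.eq_one_or_eq_neg_one {m : ℕ} {H : Matrix (Fin m) (Fin m) ℤ}
    (hH : H.IsHadamard) (i j : Fin m) : H i j = 1 ∨ H i j = -1 :=
  Int.isUnit_iff.1 (IsUnit.of_mul_eq_one _ (Unitary.mul_star_self_of_mem (hH.apply_mem i j)))

theorem hammingDist_row_row {m : ℕ} {H : Matrix (Fin m) (Fin m) ℤ} (hH : H.IsHadamard)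
    {i j : Fin m} (hij : i ≠ j) : 2 * hammingDist (signToBinary (H i)) (signToBinary (H j)) = m := by
  have he := hH.eq_one_or_eq_neg_one
  have h1 := sum_mul_eq_sub_two_mul_hammingDist (H i) (H j) (he i) (he j)
  have h2 : ∑ k, H i k * H j k = 0 := by
    have := congrFun (congrFun hH.mul_conjTranspose i) j
    simpa [Matrix.mul_apply, hij] using this
  omega

theorem signToBinary_neg {m : ℕ} (u : Fin m → ℤ) (hu : ∀ i, u i = 1 ∨ u i = -1) :
    signToBinary (-u) = signToBinary u + 1 := by
  funext i
  rcases hu i with h | h <;> simp [signToBinary, h]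
  rfl

/-- Orthogonal rows differ in half of the entries, and negating a row gives the antipode. -/
theorem isHadamardLike_hadamardCode {H : Matrix (Fin 12) (Fin 12) ℤ} (hH : H.IsHadamard) :
    IsHadamardLike (hadamardCode H) := by
  have he := hH.eq_one_or_eq_neg_one
  have hneg : ∀ i, signToBinary ((-H) i) = signToBinary (H i) + 1 := fun i =>
    signToBinary_neg (H i) (he i)
  have hmem : ∀ α, α ∈ hadamardCode H ↔
      ∃ i, α = signToBinary (H i) ∨ α = signToBinary (H i) + 1 := by
    intro α
    simp only [hadamardCode, mem_union, mem_image, mem_univ, true_and, hneg, exists_or, eq_comm]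
  have hrow : ∀ i j, hammingDist (signToBinary (H i)) (signToBinary (H j)) =
      if i = j then 0 else 6 := by
    intro i j
    split_ifs with h
    · simp [h]
    · have := hammingDist_row_row hH h
      omega
  have hrow' : ∀ i j, hammingDist (signToBinary (H i)) (signToBinary (H j) + 1) =
      if i = j then 12 else 6 := by
    intro i j
    have h1 := hammingDist_add_one (signToBinary (H i)) (signToBinary (H j))
    rw [hrow] at h1
    split_ifs at h1 ⊢ <;> omega
  have htwo : ∀ α : HammingVertex 12, α + 1 + 1 = α := fun α => by
    rw [add_assoc, CharTwo.add_self_eq_zero, add_zero]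
  refine ⟨?_, ?_, ?_⟩
  · have hinj : Function.Injective fun i => signToBinary (H i) := by
      intro i j hij
      by_contra hne
      have := hrow i j
      rw [if_neg hne] at this
      simp only at hij
      rw [hij, hammingDist_self] at this
      omega
    simp_rw [hadamardCode, hneg]
    rw [card_union_of_disjoint, card_image_of_injective _ hinj, card_image_of_injective]
    · simp
    · intro i j hij
      exact hinj (add_right_cancel hij)
    · rw [disjoint_left]
      intro α h h'
      obtain ⟨i, -, rfl⟩ := mem_image.1 h
      obtain ⟨j, -, e⟩ := mem_image.1 h'
      have := hrow' i j
      rw [e, hammingDist_self] at this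
      split_ifs at this
  · intro α hα
    obtain ⟨i, rfl | rfl⟩ := (hmem α).1 hα
    · exact (hmem _).2 ⟨i, Or.inr rfl⟩
    · exact (hmem _).2 ⟨i, Or.inl (htwo _)⟩
  · intro α hα β hβ
    obtain ⟨i, rfl | rfl⟩ := (hmem α).1 hα <;> obtain ⟨j, rfl | rfl⟩ := (hmem β).1 hβ
    · rw [hrow]
      split_ifs <;> simp
    · rw [hrow']
      split_ifs <;> simp
    · rw [hammingDist_comm, hrow']
      split_ifs <;> simp
    · have : hammingDist (signToBinary (H i) + 1) (signToBinary (H j) + 1) =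
          hammingDist (signToBinary (H i)) (signToBinary (H j)) := by
        have h1 := hammingDist_add_one (signToBinary (H i) + 1) (signToBinary (H j))
        have h2 := hammingDist_add_one (signToBinary (H j)) (signToBinary (H i))
        rw [hammingDist_comm (signToBinary (H i) + 1) (signToBinary (H j))] at h1
        rw [hammingDist_comm (signToBinary (H j)) (signToBinary (H i))] at h2
        omega
      rw [this, hrow]
      split_ifs <;> simp

/-! ### Automorphisms, standard forms and transitivity -/

theorem diffSet_permute {m : ℕ} (σ : Equiv.Perm (Fin m)) (t α β : HammingVertex m) :
    (diffSet (fun j => α (σ j) - t (σ j)) (fun j => β (σ j) - t (σ j))).map σ.toEmbedding =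
      diffSet α β := by
  ext i
  simp [mem_diffSet]

theorem hammingDist_permute {m : ℕ} (σ : Equiv.Perm (Fin m)) (t α β : HammingVertex m) :
    hammingDist (fun j => α (σ j) - t (σ j)) (fun j => β (σ j) - t (σ j)) = hammingDist α β := by
  rw [← card_diffSet α β, ← diffSet_permute σ t, card_map, card_diffSet]

/-- The automorphism that translates `t` to zero and then permutes the entries. -/
def affineAut {m : ℕ} (σ : Equiv.Perm (Fin m)) (t : HammingVertex m) : HammingAut m where
  toFun α := fun j => α (σ j) - t (σ j)
  invFun β := fun i => β (σ.symm i) + t i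
  left_inv α := by funext i; simp
  right_inv β := by funext i; simp
  map_rel_iff' := by
    intro α β
    change hammingDist _ _ = 1 ↔ hammingDist _ _ = 1
    rw [← hammingDist_permute σ t α β]
    rfl

theorem affineAut_apply {m : ℕ} (σ : Equiv.Perm (Fin m)) (t α : HammingVertex m) :
    affineAut σ t α = fun j => α (σ j) - t (σ j) := rfl

theorem affineAut_eq_flipVertex_iff {m : ℕ} (σ : Equiv.Perm (Fin m)) (t α : HammingVertex m)
    (S : Finset (Fin m)) :
    affineAut σ t α = flipVertex 0 S ↔ diffSet t α = S.map σ.toEmbedding := by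
  have h0 : (fun j => t (σ j) - t (σ j)) = (0 : HammingVertex m) := by
    funext j
    simp
  have h := diffSet_permute σ t t α
  rw [h0] at h
  rw [← h, (map_injective σ.toEmbedding).eq_iff, affineAut_apply]
  constructor
  · intro e
    rw [e, diffSet_flipVertex]
  · intro e
    rw [← e, flipVertex_diffSet]

/-- A code together with its distance cells is determined up to isometries by a standard code
with a standard vertex for each distance. -/
def HasStandardForm {m : ℕ} (C K : BinaryCode m) (v : ℕ → HammingVertex m) : Prop :=
  ∀ γ, ∃ T : HammingAut m, (∀ α β, hammingDist (T α) (T β) = hammingDist α β) ∧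
    C.image (fun α => T α) = K ∧ T γ = v (distToCode C γ)

theorem HasStandardForm.areEquivalentCodes {m : ℕ} {C D K : BinaryCode m}
    {v w : ℕ → HammingVertex m} (hC : HasStandardForm C K v) (hD : HasStandardForm D K w) :
    AreEquivalentCodes C D := by
  obtain ⟨T, -, hT, -⟩ := hC 0
  obtain ⟨U, -, hU, -⟩ := hD 0
  refine ⟨T.trans U.symm, ?_⟩
  have h : (fun α => (T.trans U.symm) α) = (fun α => U.symm α) ∘ fun α => T α := rfl
  rw [h, ← image_image, hT, ← hU, image_image]
  have h' : (fun α => U.symm α) ∘ (fun α => U α) = id := by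
    funext α
    simp
  rw [h', image_id]

theorem distToCode_image {m : ℕ} {C : BinaryCode m} (T : HammingAut m)
    (hT : ∀ α β, hammingDist (T α) (T β) = hammingDist α β) (γ : HammingVertex m) :
    distToCode (C.image fun α => T α) (T γ) = distToCode C γ := by
  simp [distToCode, hT]

/-- The isometries of the Hamming graph that preserve a code. -/
def codeStabilizer {m : ℕ} (C : BinaryCode m) : Subgroup (HammingAut m) where
  -- Building the isometry condition into the subgroup makes preservation of the cells immediate.
  carrier := {T | (∀ α β, hammingDist (T α) (T β) = hammingDist α β) ∧ ∀ α, T α ∈ C ↔ α ∈ C}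
  one_mem' := ⟨fun _ _ => rfl, fun _ => Iff.rfl⟩
  mul_mem' := fun {S T} hS hT =>
    ⟨fun α β => (hS.1 (T α) (T β)).trans (hT.1 α β), fun α => (hS.2 (T α)).trans (hT.2 α)⟩
  inv_mem' := fun {T} hT => by
    have h : ∀ α, T (T⁻¹ α) = α := fun α => T.apply_symm_apply α
    exact ⟨fun α β => by rw [← hT.1, h, h], fun α => by rw [← hT.2, h]⟩

/-- Take γ farthest from the code and α a codeword nearest to it. The vertex i steps from α towards
γ is at distance exactly i, since otherwise γ would be nearer to the code. -/
theorem exists_distToCode_eq {m : ℕ} {C : BinaryCode m} (hC : C.Nonempty) {i : ℕ}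
    (hi : i ≤ coveringRadius C) : ∃ γ, distToCode C γ = i := by
  obtain ⟨γ, -, hγ⟩ := exists_mem_eq_sup univ univ_nonempty (distToCode C)
  obtain ⟨α, hα, e⟩ := exists_hammingDist_eq_distToCode hC γ
  rw [coveringRadius, hγ, ← e, hammingDist_comm, ← card_diffSet] at hi
  obtain ⟨S, hS, hSi⟩ := exists_subset_card_eq hi
  refine ⟨flipVertex α S, le_antisymm ?_ ?_⟩
  · refine (distToCode_le hα).trans ?_
    rw [hammingDist_comm, ← card_diffSet, diffSet_flipVertex, hSi]
  · obtain ⟨β, hβ, e'⟩ := exists_hammingDist_eq_distToCode hC (flipVertex α S)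
    have h1 := distToCode_le (γ := γ) hβ
    have h2 := hammingDist_triangle γ (flipVertex α S) β
    have h3 : hammingDist γ (flipVertex α S) + i = hammingDist γ α := by
      rw [hammingDist_comm γ α, ← card_diffSet α γ, hammingDist_comm,
        hammingDist_eq_card_symmDiff α, diffSet_flipVertex, symmDiff_of_le hS,
        card_sdiff_of_subset hS, hSi]
      exact Nat.sub_add_cancel hi
    omega

/-- If T and U bring γ and γ' of the same cell to the common standard vertex, then T followed by the
inverse of U preserves C and maps γ to γ'. -/
theorem HasStandardForm.isCompletelyTransitive {m : ℕ} {C K : BinaryCode m}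
    {v : ℕ → HammingVertex m} (hC : HasStandardForm C K v) (hne : C.Nonempty) :
    IsCompletelyTransitive C := by
  refine ⟨codeStabilizer C, fun i hi => ?_⟩
  obtain ⟨γ, rfl⟩ := exists_distToCode_eq hne hi
  refine ⟨γ, ?_⟩
  ext γ'
  constructor
  · intro h
    change distToCode C γ' = distToCode C γ at h
    obtain ⟨T, hT, hTK, hTγ⟩ := hC γ
    obtain ⟨U, hU, hUK, hUγ⟩ := hC γ'
    have hTm : ∀ α, T α ∈ K ↔ α ∈ C := fun α => by
      rw [← hTK, mem_image]
      exact ⟨fun ⟨β, hβ, e⟩ => T.injective e ▸ hβ, fun h => ⟨α, h, rfl⟩⟩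
    have hUm : ∀ α, U α ∈ K ↔ α ∈ C := fun α => by
      rw [← hUK, mem_image]
      exact ⟨fun ⟨β, hβ, e⟩ => U.injective e ▸ hβ, fun h => ⟨α, h, rfl⟩⟩
    refine ⟨⟨T.trans U.symm, ?_, ?_⟩, ?_⟩
    · intro α β
      change hammingDist (U.symm (T α)) (U.symm (T β)) = _
      rw [← hU, U.apply_symm_apply, U.apply_symm_apply, hT]
    · intro α
      change U.symm (T α) ∈ C ↔ _
      rw [← hUm, U.apply_symm_apply, hTm]
    · change U.symm (T γ) = γ'
      rw [hTγ, ← h, ← hUγ, U.symm_apply_apply]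
  · rintro ⟨⟨T, hT, hTC⟩, rfl⟩
    change distToCode C (T γ) = distToCode C γ
    have hTK : (C.image fun α => T α) = C := by
      apply eq_of_subset_of_card_le
      · intro x hx
        obtain ⟨α, hα, rfl⟩ := mem_image.1 hx
        exact (hTC α).2 hα
      · rw [card_image_of_injective _ T.injective]
    conv_lhs => rw [← hTK]
    exact distToCode_image T hT γ

end

/-! ### Standard forms of the Hadamard codes and their punctured codes -/

section

open Finset symmDiff

/-- The binary code of length twelve whose supports form the standard Hadamard family. -/
def standardHadamardCode : BinaryCode 12 :=
  univ.filter fun x => diffSet 0 x ∈ standardHadamardFamily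

/-- Representatives for the coset leaders of the standard Hadamard code, by weight. -/
def standardLeader : ℕ → Finset (Fin 12)
  | 0 => ∅
  | 1 => {0}
  | 2 => {0, 1}
  | 3 => {0, 1, 2}
  -- Only weight 4 uses this default; 9 labels a point of the fourth cell of {0, 1, 2}.
  | _ => {0, 1, 2, 9}

/-- Representatives for the coset leaders of the punctured standard Hadamard code, by weight. -/
def standardPuncturedLeader : ℕ → Finset (Fin 11)
  | 0 => ∅
  | 1 => {0}
  | 2 => {0, 1}
  -- Used for weight 3: the points 1, 2, 9 shifted down by deletion of the entry 0.
  | _ => {0, 1, 8}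

theorem exists_two_further (p : Fin 12) : ∃ q r, p ≠ q ∧ p ≠ r ∧ q ≠ r := by
  revert p
  decide

theorem exists_ne_ne (p q : Fin 12) : ∃ r, p ≠ r ∧ q ≠ r := by
  revert p q
  decide

theorem IsHadamardFamily.exists_perm_map_standardLeader {F : Finset (Finset (Fin 12))}
    (hF : IsHadamardFamily F) {S : Finset (Fin 12)} (hS : ∀ B ∈ F, #S ≤ #(S ∆ B)) :
    ∃ σ : Equiv.Perm (Fin 12), S = (standardLeader #S).map σ.toEmbedding ∧
      ∀ A : Finset (Fin 12), A.map σ.toEmbedding ∈ F ↔ A ∈ standardHadamardFamily := by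
  have h4 := hF.card_le_four hS
  obtain h | h | h | h | h : #S = 0 ∨ #S = 1 ∨ #S = 2 ∨ #S = 3 ∨ #S = 4 := by omega
  · obtain ⟨q, r, hpq, hpr, hqr⟩ := exists_two_further 0
    obtain ⟨σ, -, -, -, hσ⟩ := hF.exists_perm_of_triple hpq hpr hqr
    refine ⟨σ, ?_, hσ⟩
    rw [h, card_eq_zero.1 h]
    rfl
  · obtain ⟨p, e⟩ := card_eq_one.1 h
    obtain ⟨q, r, hpq, hpr, hqr⟩ := exists_two_further p
    obtain ⟨σ, h0, -, -, hσ⟩ := hF.exists_perm_of_triple hpq hpr hqr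
    refine ⟨σ, ?_, hσ⟩
    rw [h, e]
    simp [standardLeader, h0]
  · obtain ⟨p, q, hpq, e⟩ := card_eq_two.1 h
    obtain ⟨r, hpr, hqr⟩ := exists_ne_ne p q
    obtain ⟨σ, h0, h1, -, hσ⟩ := hF.exists_perm_of_triple hpq hpr hqr
    refine ⟨σ, ?_, hσ⟩
    rw [h, e]
    simp [standardLeader, h0, h1]
  · obtain ⟨p, q, r, hpq, hpr, hqr, e⟩ := card_eq_three.1 h
    obtain ⟨σ, h0, h1, h2, hσ⟩ := hF.exists_perm_of_triple hpq hpr hqr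
    refine ⟨σ, ?_, hσ⟩
    rw [h, e]
    simp [standardLeader, h0, h1, h2]
  · obtain ⟨s, T, hsT, e, hT⟩ := card_eq_succ.1 h
    obtain ⟨p, q, r, hpq, hpr, hqr, rfl⟩ := card_eq_three.1 hT
    have hs := hsT
    simp only [mem_insert, mem_singleton, not_or] at hs
    -- A block containing all of S would be at distance 2 from S, against minimality.
    obtain ⟨σ, h0, h1, h2, h9, hσ⟩ := hF.exists_perm hpq hpr hqr hs.1 hs.2.1 hs.2.2 (by
      intro B hB hB6 hp hq hr hsB
      have h1 := hS B hB
      have h2 := card_symmDiff_add_two_mul_card_inter S B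
      rw [inter_eq_left.2 (by rw [← e]; simp [insert_subset_iff, hp, hq, hr, hsB])] at h2
      omega)
    refine ⟨σ, ?_, hσ⟩
    rw [h, ← e]
    ext x
    simp only [standardLeader, map_insert, map_singleton, Equiv.coe_toEmbedding, h0, h1, h2, h9,
      mem_insert, mem_singleton]
    tauto

theorem image_affineAut_eq_standardHadamardCode {C : BinaryCode 12} {α : HammingVertex 12}
    {σ : Equiv.Perm (Fin 12)}
    (hσ : ∀ A : Finset (Fin 12), A.map σ.toEmbedding ∈ codeFamily C α ↔
      A ∈ standardHadamardFamily) :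
    C.image (fun β => affineAut σ α β) = standardHadamardCode := by
  ext x
  simp only [mem_image, standardHadamardCode, mem_filter, mem_univ, true_and]
  rw [← hσ, mem_codeFamily]
  refine exists_congr fun β => and_congr_right fun _ => ?_
  rw [← affineAut_eq_flipVertex_iff, flipVertex_diffSet]

theorem le_card_symmDiff_of_hammingDist_eq {m : ℕ} {C : BinaryCode m} {α γ : HammingVertex m}
    (h : hammingDist γ α = distToCode C γ) :
    ∀ B ∈ codeFamily C α, #(diffSet α γ) ≤ #(diffSet α γ ∆ B) := by
  intro B hB
  obtain ⟨β, hβ, rfl⟩ := mem_codeFamily.1 hB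
  rw [← hammingDist_eq_card_symmDiff, card_diffSet, hammingDist_comm, h]
  exact distToCode_le hβ

theorem IsHadamardLike.nonempty {C : BinaryCode 12} (hC : IsHadamardLike C) : C.Nonempty :=
  card_pos.1 (by rw [hC.card_eq]; norm_num)

theorem IsHadamardLike.hasStandardForm {C : BinaryCode 12} (hC : IsHadamardLike C) :
    HasStandardForm C standardHadamardCode (fun d => flipVertex 0 (standardLeader d)) := by
  intro γ
  obtain ⟨α, hα, e⟩ := exists_hammingDist_eq_distToCode hC.nonempty γ
  obtain ⟨σ, hS, hσ⟩ := (hC.isHadamardFamily hα).exists_perm_map_standardLeader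
    (le_card_symmDiff_of_hammingDist_eq e)
  refine ⟨affineAut σ α, hammingDist_permute σ α, image_affineAut_eq_standardHadamardCode hσ, ?_⟩
  rw [affineAut_eq_flipVertex_iff, ← e, hammingDist_comm, ← card_diffSet]
  exact hS

/-- The vertex obtained by deleting the first entry. -/
def punctureVertex {m : ℕ} (α : HammingVertex (m + 1)) : HammingVertex m :=
  fun j => α (Fin.succAbove 0 j)

theorem punctureVertex_apply {m : ℕ} (α : HammingVertex (m + 1)) (j : Fin m) :
    punctureVertex α j = α j.succ := by
  rw [punctureVertex, Fin.succAbove_zero]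

theorem cons_punctureVertex {m : ℕ} (α : HammingVertex (m + 1)) :
    (Fin.cons (α 0) (punctureVertex α) : HammingVertex (m + 1)) = α := by
  funext i
  refine Fin.cases rfl (fun j => ?_) i
  rw [Fin.cons_succ, punctureVertex_apply]

theorem mem_puncturedCode {m : ℕ} {E : BinaryCode (m + 1)} {α : HammingVertex m} :
    α ∈ puncturedCode 0 E ↔ ∃ β ∈ E, punctureVertex β = α := mem_image

theorem map_succ_diffSet_punctureVertex {m : ℕ} (α β : HammingVertex (m + 1)) :
    (diffSet (punctureVertex α) (punctureVertex β)).map (Fin.succEmb m) =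
      (diffSet α β).erase 0 := by
  ext i
  refine Fin.cases ?_ (fun j => ?_) i
  · simp
  · simp [mem_diffSet, punctureVertex_apply]

/-- Extend γ by the entry that makes its distances to the code odd. The distance to a nearest
codeword is at most 4, hence at most 3, and puncturing does not increase it. -/
theorem IsHadamardLike.exists_hammingDist_punctureVertex_le {E : BinaryCode 12}
    (hE : IsHadamardLike E) (γ : HammingVertex 11) :
    ∃ β ∈ E, hammingDist γ (punctureVertex β) ≤ 3 := by
  obtain ⟨α, hα⟩ := hE.nonempty
  have hF := hE.isHadamardFamily hα
  obtain ⟨c, hc⟩ : ∃ c : ZMod 2, #(diffSet α (Fin.cons c γ)) % 2 = 1 := by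
    have h : ∀ c, #(diffSet α (Fin.cons c γ)) =
        (if α 0 = c then 0 else 1) + hammingDist (punctureVertex α) γ := by
      intro c
      rw [card_diffSet, ← hammingDist_cons, cons_punctureVertex]
    rcases Nat.mod_two_eq_zero_or_one (hammingDist (punctureVertex α) γ) with h2 | h2
    · refine ⟨α 0 + 1, ?_⟩
      rw [h, if_neg (by simp)]
      omega
    · refine ⟨α 0, ?_⟩
      rw [h, if_pos rfl]
      omega
  obtain ⟨β, hβ, e⟩ := exists_hammingDist_eq_distToCode hE.nonempty (Fin.cons c γ)
  have h4 := (hE.isHadamardFamily hβ).card_le_four (le_card_symmDiff_of_hammingDist_eq e)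
  have h1 : hammingDist β (Fin.cons c γ) =
      (if β 0 = c then 0 else 1) + hammingDist (punctureVertex β) γ := by
    rw [← hammingDist_cons, cons_punctureVertex]
  have h2 := card_symmDiff_add_two_mul_card_inter (diffSet α β) (diffSet α (Fin.cons c γ))
  rw [← hammingDist_eq_card_symmDiff, card_diffSet α β] at h2
  rw [card_diffSet] at h4
  have h3 := hE.hammingDist_mem α hα β hβ
  refine ⟨β, hβ, ?_⟩
  rw [hammingDist_comm]
  omega

theorem exists_perm_succ {m : ℕ} {σ : Equiv.Perm (Fin (m + 1))} (h : σ 0 = 0) :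
    ∃ τ : Equiv.Perm (Fin m), ∀ j, σ j.succ = (τ j).succ := by
  obtain ⟨⟨p, τ⟩, rfl⟩ := Equiv.Perm.decomposeFin.symm.surjective σ
  rw [Equiv.Perm.decomposeFin_symm_apply_zero] at h
  subst h
  exact ⟨τ, fun j => by simp [Equiv.Perm.decomposeFin_symm_apply_succ]⟩

theorem punctureVertex_affineAut {m : ℕ} {σ : Equiv.Perm (Fin (m + 1))}
    {τ : Equiv.Perm (Fin m)} (h : ∀ j, σ j.succ = (τ j).succ) (α β : HammingVertex (m + 1)) :
    punctureVertex (affineAut σ α β) = affineAut τ (punctureVertex α) (punctureVertex β) := by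
  funext j
  simp only [affineAut_apply, punctureVertex_apply, h]

theorem succ_ne_succ {m : ℕ} {a b : Fin m} (h : a ≠ b) : a.succ ≠ b.succ :=
  fun e => h (Fin.succ_injective _ e)

/-- Taking the deleted point 0 as first point of the triple makes σ fix 0 and descend to the other
eleven points. In weight 3, 0 and S form a set of size 4 on no block. -/
theorem IsHadamardFamily.exists_perm_map_standardPuncturedLeader {F : Finset (Finset (Fin 12))}
    (hF : IsHadamardFamily F) {S : Finset (Fin 11)} (h3 : #S ≤ 3)
    (hS : #S = 3 → ∀ B ∈ F, #B = 6 → 0 ∈ B → ¬ S.map (Fin.succEmb 11) ⊆ B) :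
    ∃ (σ : Equiv.Perm (Fin 12)) (τ : Equiv.Perm (Fin 11)), (∀ j, σ j.succ = (τ j).succ) ∧
      S = (standardPuncturedLeader #S).map τ.toEmbedding ∧
      ∀ A : Finset (Fin 12), A.map σ.toEmbedding ∈ F ↔ A ∈ standardHadamardFamily := by
  have hne : ∀ a : Fin 11, (0 : Fin 12) ≠ a.succ := fun a => (Fin.succ_ne_zero a).symm
  have hpt : ∀ (σ : Equiv.Perm (Fin 12)) (τ : Equiv.Perm (Fin 11)),
      (∀ j, σ j.succ = (τ j).succ) → ∀ i j, σ i.succ = j.succ → τ i = j := by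
    intro σ τ hτ i j h
    rw [hτ] at h
    exact Fin.succ_injective _ h
  obtain h | h | h | h : #S = 0 ∨ #S = 1 ∨ #S = 2 ∨ #S = 3 := by omega
  · obtain ⟨q, r, hpq, hpr, hqr⟩ := exists_two_further 0
    obtain ⟨σ, h0, -, -, hσ⟩ := hF.exists_perm_of_triple hpq hpr hqr
    obtain ⟨τ, hτ⟩ := exists_perm_succ h0
    refine ⟨σ, τ, hτ, ?_, hσ⟩
    rw [h, card_eq_zero.1 h]
    rfl
  · obtain ⟨q, e⟩ := card_eq_one.1 h
    obtain ⟨r, hpr, hqr⟩ := exists_ne_ne 0 q.succ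
    obtain ⟨σ, h0, h1, -, hσ⟩ := hF.exists_perm_of_triple (hne q) hpr hqr
    obtain ⟨τ, hτ⟩ := exists_perm_succ h0
    refine ⟨σ, τ, hτ, ?_, hσ⟩
    rw [h, e]
    simp [standardPuncturedLeader, hpt σ τ hτ 0 q h1]
  · obtain ⟨q, r, hqr, e⟩ := card_eq_two.1 h
    obtain ⟨σ, h0, h1, h2, hσ⟩ :=
      hF.exists_perm_of_triple (hne q) (hne r) (succ_ne_succ hqr)
    obtain ⟨τ, hτ⟩ := exists_perm_succ h0
    refine ⟨σ, τ, hτ, ?_, hσ⟩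
    rw [h, e]
    simp [standardPuncturedLeader, hpt σ τ hτ 0 q h1, hpt σ τ hτ 1 r h2]
  · obtain ⟨q, r, s, hqr, hqs, hrs, e⟩ := card_eq_three.1 h
    obtain ⟨σ, h0, h1, h2, h9, hσ⟩ := hF.exists_perm (hne q) (hne r) (succ_ne_succ hqr)
      (hne s).symm (succ_ne_succ hqs.symm) (succ_ne_succ hrs.symm) (by
        intro B hB hB6 h0 hq hr hs
        apply hS h B hB hB6 h0
        rw [e]
        simp [insert_subset_iff, hq, hr, hs])
    obtain ⟨τ, hτ⟩ := exists_perm_succ h0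
    refine ⟨σ, τ, hτ, ?_, hσ⟩
    rw [h, e]
    simp [standardPuncturedLeader, hpt σ τ hτ 0 q h1, hpt σ τ hτ 1 r h2, hpt σ τ hτ 8 s h9]

theorem IsHadamardLike.hasStandardForm_puncturedCode {E : BinaryCode 12}
    (hE : IsHadamardLike E) :
    HasStandardForm (puncturedCode 0 E) (puncturedCode 0 standardHadamardCode)
      (fun d => flipVertex 0 (standardPuncturedLeader d)) := by
  intro γ
  obtain ⟨α', hα', e⟩ := exists_hammingDist_eq_distToCode
    (C := puncturedCode 0 E) (hE.nonempty.image _) γ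
  obtain ⟨α, hα, rfl⟩ := mem_puncturedCode.1 hα'
  have h3 : #(diffSet (punctureVertex α) γ) ≤ 3 := by
    obtain ⟨β, hβ, h⟩ := hE.exists_hammingDist_punctureVertex_le γ
    rw [card_diffSet, hammingDist_comm, e]
    exact (distToCode_le (mem_puncturedCode.2 ⟨β, hβ, rfl⟩)).trans h
  obtain ⟨σ, τ, hτ, hS, hσ⟩ :=
    -- A block through 0 and S punctures to a word of weight 5 containing S, at distance 2 < 3.
    (hE.isHadamardFamily hα).exists_perm_map_standardPuncturedLeader h3 (by
      intro hS B hB hB6 h0 hSB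
      obtain ⟨β, hβ, rfl⟩ := mem_codeFamily.1 hB
      have h1 := le_card_symmDiff_of_hammingDist_eq e
        (diffSet (punctureVertex α) (punctureVertex β))
        (mem_codeFamily.2 ⟨_, mem_puncturedCode.2 ⟨β, hβ, rfl⟩, rfl⟩)
      have h2 := card_symmDiff_add_two_mul_card_inter (diffSet (punctureVertex α) γ)
        (diffSet (punctureVertex α) (punctureVertex β))
      have h4 := congrArg card (map_succ_diffSet_punctureVertex α β)
      rw [card_map, card_erase_of_mem h0, hB6] at h4
      rw [inter_eq_left.2, h4] at h2
      · omega
      · rw [← map_subset_map (f := Fin.succEmb 11), map_succ_diffSet_punctureVertex,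
          subset_erase]
        exact ⟨hSB, by simp⟩)
  refine ⟨affineAut τ (punctureVertex α), hammingDist_permute τ (punctureVertex α), ?_, ?_⟩
  · rw [← image_affineAut_eq_standardHadamardCode hσ]
    change image _ (image punctureVertex E) = image punctureVertex (image _ E)
    rw [image_image, image_image]
    congr 1
    funext β
    exact (punctureVertex_affineAut hτ α β).symm
  · rw [affineAut_eq_flipVertex_iff, ← e, hammingDist_comm, ← card_diffSet]
    exact hS

end

theorem theorem1 :
    (∀ C : BinaryCode 12, IsCompletelyRegular C → HasMinDistance C 6 →
      (∀ D : BinaryCode 12, IsHadamardTwelveCode D → AreEquivalentCodes C D) ∧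
        IsCompletelyTransitive C) ∧
    (∀ C : BinaryCode 11, IsCompletelyRegular C → HasMinDistance C 5 →
      (∀ D : BinaryCode 11, IsPuncturedHadamardTwelveCode D → AreEquivalentCodes C D) ∧
        IsCompletelyTransitive C) := by
  refine ⟨fun C hC hδ => ?_, fun C hC hδ => ?_⟩
  · have hL := isHadamardLike_of_isCompletelyRegular hC hδ
    refine ⟨?_, hL.hasStandardForm.isCompletelyTransitive hL.nonempty⟩
    rintro D ⟨H, hH, -, -, rfl⟩
    exact hL.hasStandardForm.areEquivalentCodes (isHadamardLike_hadamardCode hH).hasStandardForm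
  · obtain ⟨E, hE, rfl⟩ := exists_isHadamardLike_of_isCompletelyRegular hC hδ
    refine ⟨?_, hE.hasStandardForm_puncturedCode.isCompletelyTransitive (hE.nonempty.image _)⟩
    rintro D ⟨_, ⟨H, hH, -, -, rfl⟩, rfl⟩
    exact hE.hasStandardForm_puncturedCode.areEquivalentCodes
      (isHadamardLike_hadamardCode hH).hasStandardForm_puncturedCode
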